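/- Let $\eta\in\mathbb C\setminus\{0,1\}$ and $\alpha_0,\dots,\alpha_5\in\mathbb C$. Put $$\begin{aligned} H_{VI}(q,p,t;\beta_1,\beta_2,\beta_3,\beta_4)=\frac{1}{t(t-1)(t-\eta)}\Big[&q(q-1)(q-\eta)(q-t)p^2\\ &+\{\beta_1(t-\eta)q(q-1)+2\beta_2q(q-1)(q-\eta)+\beta_3(t-1)q(q-\eta)+\beta_4t(q-1)(q-\eta)\}p\\ &+\beta_2\{(\beta_1+\beta_2)(t-\eta)+\beta_2(q-1)+\beta_3(t-1)+t\beta_4\}q\Big], \end{aligned}$$ $$\begin{aligned} \hat H_1=\;&H_{VI}(q_1,p_1,t;\alpha_1,\alpha_2,\alpha_3,\alpha_4)\\ &+\alpha_2p_2\Big\{\tfrac{-(t-1)sq_1+t(s-1)q_2+(t-s)q_1q_2}{t(t-1)(t-s)}+\tfrac{(q_1-t)q_2(q_2-1)}{t(t-1)(t-\eta)}\Big\}\\ &+\alpha_5p_1\Big\{\tfrac{(t-s)q_1(q_1-1)+t(t-1)(q_1-q_2)}{t(t-1)(t-s)}+\tfrac{(q_1-t)((t-1)q_1+(q_1-t)q_2)}{t(t-1)(t-\eta)}\Big\}\\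 &-p_1p_2\Big\{\tfrac{(t-1)(sq_1^2+tq_2^2)-(t-s)q_2(q_1^2+t)-2t(s-1)q_1q_2}{t(t-1)(t-s)}-\tfrac{(q_1-t)^2q_2(q_2-1)}{t(t-1)(t-\eta)}\Big\}\\ &+\frac{\alpha_2\alpha_5(2tq_1-q_1-tq_2+q_1q_2-\eta q_1)}{t(t-1)(t-\eta)}, \end{aligned}$$ and let $\hat H_2=\pi(\hat H_1)$ be obtained from $\hat H_1$ by exchanging $q_1\leftrightarrow q_2$, $p_1\leftrightarrow p_2$, $t\leftrightarrow s$, $\alpha_2\leftrightarrow\alpha_5$. For $H_1,H_2\in\mathbb C(t,s)[q_1,p_1,q_2,p_2]$ consider the Hamiltonian system $$dq_i=\frac{\partial H_1}{\partial p_i}dt+\frac{\partial H_2}{\partial p_i}ds,\qquad dp_i=-\frac{\partial H_1}{\partial q_i}dt-\frac{\partial H_2}{\partial q_i}ds\qquad(i=1,2).\tag{1}$$ Assume that $H_1$ and $H_2$ both have total degree $6$ in $q_1,p_1,q_2,p_2$, and that in each of the following six coordinate systems $r_j:(x,y,z,w)$ the system is again a polynomial Hamiltonian system, i.e. there are $K_1,K_2\in\mathbb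 C(t,s)[x,y,z,w]$ (depending on $j$) such that (1) becomes $dx=\frac{\partial K_1}{\partial y}dt+\frac{\partial K_2}{\partial y}ds$, $dy=-\frac{\partial K_1}{\partial x}dt-\frac{\partial K_2}{\partial x}ds$, $dz=\frac{\partial K_1}{\partial w}dt+\frac{\partial K_2}{\partial w}ds$, $dw=-\frac{\partial K_1}{\partial z}dt-\frac{\partial K_2}{\partial z}ds$: $$\begin{aligned} r_0&:\ x=-p_1((q_1-t)p_1+(q_2-s)p_2-\alpha_0),\ y=\tfrac1{p_1},\ z=(q_2-s)p_1,\ w=\tfrac{p_2}{p_1},\\ r_1&:\ x=-p_1((q_1-\eta)p_1+(q_2-\eta)p_2-\alpha_1),\ y=\tfrac1{p_1},\ z=(q_2-\eta)p_1,\ w=\tfrac{p_2}{p_1},\\ r_2&:\ x=\tfrac1{q_1},\ y=-q_1(q_1p_1+\alpha_2),\ z=q_2,\ w=p_2,\\ r_3&:\ x=-p_1((q_1-1)p_1+(q_2-1)p_2-\alpha_3),\ y=\tfrac1{p_1},\ z=(q_2-1)p_1,\ w=\tfrac{p_2}{p_1},\\ r_4&:\ x=-p_1(q_1p_1+q_2p_2-\alpha_4),\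 y=\tfrac1{p_1},\ z=q_2p_1,\ w=\tfrac{p_2}{p_1},\\ r_5&:\ x=q_1,\ y=p_1,\ z=\tfrac1{q_2},\ w=-(q_2p_2+\alpha_5)q_2. \end{aligned}$$ Then the system coincides with the system (1) with Hamiltonians $\hat H_1,\hat H_2$ if and only if $$\alpha_0+\alpha_1+2\alpha_2+\alpha_3+\alpha_4+2\alpha_5=1.$$ In other words: under this parameter relation such a system is exactly the system with Hamiltonians $\hat H_1,\hat H_2$, and the system with Hamiltonians $\hat H_1,\hat H_2$ can satisfy the conditions in the six charts only if the relation holds. -/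

import Mathlib

open MvPolynomial

noncomputable section

namespace Garnier

/-! ### The rings -/

/-- The field `ℂ(t, s)` of rational functions of the two times. -/
abbrev TimeField : Type := FractionRing (MvPolynomial (Fin 2) ℂ)

/-- The ring `ℂ(t, s)[X₀, X₁, X₂, X₃]`. On the original phase space the variables are
`(X₀, X₁, X₂, X₃) = (q₁, p₁, q₂, p₂)`; in a chart they are `(x, y, z, w)`.
So `X₀, X₁` and `X₂, X₃` are the two conjugate pairs. -/
abbrev PhaseRing : Type := MvPolynomial (Fin 4) TimeField

/-- The field `ℂ(t, s)(q₁, p₁, q₂, p₂)`. -/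
abbrev PhaseField : Type := FractionRing PhaseRing

/-- The times: `time 0 = t` and `time 1 = s`. -/
def time (k : Fin 2) : TimeField := algebraMap (MvPolynomial (Fin 2) ℂ) TimeField (X k)

/-- The phase space coordinates `q₁, p₁, q₂, p₂` as elements of the field of rational functions. -/
def coord (i : Fin 4) : PhaseField := algebraMap PhaseRing PhaseField (X i)

/-! ### Hamiltonian vector fields and total derivatives -/

/-- The Hamiltonian vector field of `H` for the form `dX₀ ∧ dX₁ + dX₂ ∧ dX₃`:
`(∂H/∂X₁, -∂H/∂X₀, ∂H/∂X₃, -∂H/∂X₂)`. -/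
def hamVF (H : PhaseRing) : Fin 4 → PhaseRing :=
  ![pderiv 1 H, -pderiv 0 H, pderiv 3 H, -pderiv 2 H]

/-- First order shift of the `k`-th time on polynomials in `t, s`:
`f(t, s) ↦ f(t + ε, s)` for `k = 0` and `f(t, s + ε)` for `k = 1`, where `ε² = 0`. -/
def shiftPoly (k : Fin 2) : MvPolynomial (Fin 2) ℂ →+* DualNumber PhaseField :=
  eval₂Hom (algebraMap ℂ (DualNumber PhaseField)) fun i =>
    TrivSqZeroExt.inl (algebraMap TimeField PhaseField (time i)) +
      TrivSqZeroExt.inr (if i = k then 1 else 0)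

lemma fst_shiftPoly (k : Fin 2) (f : MvPolynomial (Fin 2) ℂ) :
    (shiftPoly k f).fst =
      algebraMap TimeField PhaseField (algebraMap (MvPolynomial (Fin 2) ℂ) TimeField f) := by
  have h : (TrivSqZeroExt.fstHom ℂ PhaseField PhaseField).toRingHom.comp (shiftPoly k) =
      (algebraMap TimeField PhaseField).comp (algebraMap (MvPolynomial (Fin 2) ℂ) TimeField) := by
    apply MvPolynomial.ringHom_ext
    · intro c
      simp only [shiftPoly, RingHom.comp_apply, coe_eval₂Hom, eval₂_C, AlgHom.toRingHom_eq_coe,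
        RingHom.coe_coe, AlgHom.commutes]
      rw [← MvPolynomial.algebraMap_eq, ← IsScalarTower.algebraMap_apply ℂ _ TimeField,
        ← IsScalarTower.algebraMap_apply ℂ TimeField PhaseField]
    · intro i
      by_cases hik : i = k <;> simp [shiftPoly, time, hik]
  exact congrArg (fun g => g f) h

/-- The shift of the `k`-th time on `ℂ(t, s)`. -/
def shiftTime (k : Fin 2) : TimeField →+* DualNumber PhaseField :=
  IsLocalization.lift (M := nonZeroDivisors (MvPolynomial (Fin 2) ℂ)) (g := shiftPoly k) fun y => by
    rw [TrivSqZeroExt.isUnit_iff_isUnit_fst, fst_shiftPoly, isUnit_iff_ne_zero]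
    simp

lemma fst_shiftTime (k : Fin 2) (f : TimeField) :
    (shiftTime k f).fst = algebraMap TimeField PhaseField f := by
  have h : (TrivSqZeroExt.fstHom ℂ PhaseField PhaseField).toRingHom.comp (shiftTime k) =
      algebraMap TimeField PhaseField := by
    apply IsLocalization.ringHom_ext (nonZeroDivisors (MvPolynomial (Fin 2) ℂ))
    refine RingHom.ext fun f => ?_
    simp [shiftTime, fst_shiftPoly]
  exact congrArg (fun g => g f) h

/-- First order displacement along the flow of `H` in the `k`-th time, on polynomials:
the `k`-th time is shifted by `ε` and `Xᵢ` goes to `Xᵢ + ε vᵢ`, where `v = hamVF H`. -/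
def flowPoly (k : Fin 2) (H : PhaseRing) : PhaseRing →+* DualNumber PhaseField :=
  eval₂Hom (shiftTime k) fun i =>
    TrivSqZeroExt.inl (coord i) + TrivSqZeroExt.inr (algebraMap PhaseRing PhaseField (hamVF H i))

lemma fst_flowPoly (k : Fin 2) (H f : PhaseRing) :
    (flowPoly k H f).fst = algebraMap PhaseRing PhaseField f := by
  have h : (TrivSqZeroExt.fstHom ℂ PhaseField PhaseField).toRingHom.comp (flowPoly k H) =
      algebraMap PhaseRing PhaseField := by
    apply MvPolynomial.ringHom_ext
    · intro c
      simp only [flowPoly, RingHom.comp_apply, coe_eval₂Hom, eval₂_C, AlgHom.toRingHom_eq_coe,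
        RingHom.coe_coe, TrivSqZeroExt.fstHom_apply, fst_shiftTime]
      rw [← MvPolynomial.algebraMap_eq, ← IsScalarTower.algebraMap_apply TimeField _ PhaseField]
    · intro i
      simp [flowPoly, coord]
  exact congrArg (fun g => g f) h

/-- First order displacement along the flow of `H` in the `k`-th time, on rational functions. -/
def flow (k : Fin 2) (H : PhaseRing) : PhaseField →+* DualNumber PhaseField :=
  IsLocalization.lift (M := nonZeroDivisors PhaseRing) (g := flowPoly k H) fun y => by
    rw [TrivSqZeroExt.isUnit_iff_isUnit_fst, fst_flowPoly, isUnit_iff_ne_zero]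
    simp

lemma fst_flow (k : Fin 2) (H : PhaseRing) (f : PhaseField) : (flow k H f).fst = f := by
  have h : (TrivSqZeroExt.fstHom ℂ PhaseField PhaseField).toRingHom.comp (flow k H) =
      RingHom.id PhaseField := by
    apply IsLocalization.ringHom_ext (nonZeroDivisors PhaseRing)
    refine RingHom.ext fun f => ?_
    simp [flow, fst_flowPoly]
  exact congrArg (fun g => g f) h

lemma flow_algebraMap (k : Fin 2) (H : PhaseRing) (c : ℂ) :
    flow k H (algebraMap ℂ PhaseField c) = algebraMap ℂ (DualNumber PhaseField) c := by
  rw [IsScalarTower.algebraMap_apply ℂ PhaseRing PhaseField, flow, IsLocalization.lift_eq,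
    IsScalarTower.algebraMap_apply ℂ TimeField PhaseRing, MvPolynomial.algebraMap_eq, flowPoly,
    coe_eval₂Hom, eval₂_C, IsScalarTower.algebraMap_apply ℂ (MvPolynomial (Fin 2) ℂ) TimeField,
    shiftTime, IsLocalization.lift_eq, MvPolynomial.algebraMap_eq, shiftPoly, coe_eval₂Hom, eval₂_C]

/-- The total derivative `d/dt` (for `k = 0`) or `d/ds` (for `k = 1`) of a rational function of
`t, s, q₁, p₁, q₂, p₂` along the Hamiltonian vector field of `H`: the coefficient of `ε` in its
first order displacement. It is the derivation `∂/∂(time k) + ∑ᵢ (hamVF H)ᵢ ∂/∂Xᵢ`. -/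
def totalDeriv (k : Fin 2) (H : PhaseRing) : Derivation ℂ PhaseField PhaseField where
  toFun f := (flow k H f).snd
  map_add' f g := by rw [RingHom.map_add, TrivSqZeroExt.snd_add]
  map_smul' c f := by
    rw [Algebra.smul_def, map_mul, flow_algebraMap, ← Algebra.smul_def, TrivSqZeroExt.snd_smul,
      RingHom.id_apply]
  map_one_eq_zero' := by simp
  leibniz' f g := by
    change (flow k H (f * g)).snd = f • (flow k H g).snd + g • (flow k H f).snd
    rw [RingHom.map_mul, TrivSqZeroExt.snd_mul, fst_flow, fst_flow, op_smul_eq_smul]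

lemma totalDeriv_coord (k : Fin 2) (H : PhaseRing) (i : Fin 4) :
    totalDeriv k H (coord i) = algebraMap PhaseRing PhaseField (hamVF H i) := by
  change (flow k H (coord i)).snd = _
  rw [coord, flow, IsLocalization.lift_eq, flowPoly, coe_eval₂Hom, eval₂_X, TrivSqZeroExt.snd_add,
    TrivSqZeroExt.snd_inl, TrivSqZeroExt.snd_inr, zero_add]

lemma totalDeriv_time (k : Fin 2) (H : PhaseRing) (i : Fin 2) :
    totalDeriv k H (algebraMap TimeField PhaseField (time i)) = if i = k then 1 else 0 := by
  change (flow k H _).snd = _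
  rw [IsScalarTower.algebraMap_apply TimeField PhaseRing PhaseField, flow, IsLocalization.lift_eq,
    MvPolynomial.algebraMap_eq, flowPoly, coe_eval₂Hom, eval₂_C, time, shiftTime,
    IsLocalization.lift_eq]
  rw [shiftPoly, coe_eval₂Hom, eval₂_X, TrivSqZeroExt.snd_add, TrivSqZeroExt.snd_inl,
    TrivSqZeroExt.snd_inr, zero_add]

/-! ### Systems in charts -/

/-- The system
`dq₁ = ∂H₁/∂p₁ dt + ∂H₂/∂p₁ ds`, `dp₁ = -∂H₁/∂q₁ dt - ∂H₂/∂q₁ ds`,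
`dq₂ = ∂H₁/∂p₂ dt + ∂H₂/∂p₂ ds`, `dp₂ = -∂H₁/∂q₂ dt - ∂H₂/∂q₂ ds`:
its coefficients of `dt` and of `ds`. -/
def hamSystem (H₁ H₂ : PhaseRing) : (Fin 4 → PhaseRing) × (Fin 4 → PhaseRing) :=
  (hamVF H₁, hamVF H₂)

/-- In the coordinates `r = (x, y, z, w)`, the system with Hamiltonians `H₁, H₂` is again a
polynomial Hamiltonian system: there are `K₁, K₂ ∈ ℂ(t,s)[x, y, z, w]` with
`dx = ∂K₁/∂y dt + ∂K₂/∂y ds`, `dy = -∂K₁/∂x dt - ∂K₂/∂x ds`,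
`dz = ∂K₁/∂w dt + ∂K₂/∂w ds`, `dw = -∂K₁/∂z dt - ∂K₂/∂z ds` along the system. -/
def IsPolyHamIn (H₁ H₂ : PhaseRing) (r : Fin 4 → PhaseField) : Prop :=
  ∃ K₁ K₂ : PhaseRing, ∀ i : Fin 4,
    totalDeriv 0 H₁ (r i) = aeval r (hamVF K₁ i) ∧
    totalDeriv 1 H₂ (r i) = aeval r (hamVF K₂ i)

/-- The coordinates
`x = -p₁((q₁-a)p₁ + (q₂-b)p₂ - α)`, `y = 1/p₁`, `z = (q₂-b)p₁`, `w = p₂/p₁`. -/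
def blowupChart (a b α : PhaseField) : Fin 4 → PhaseField :=
  let q₁ := coord 0
  let p₁ := coord 1
  let q₂ := coord 2
  let p₂ := coord 3
  ![-p₁ * ((q₁ - a) * p₁ + (q₂ - b) * p₂ - α), 1 / p₁, (q₂ - b) * p₁, p₂ / p₁]

/-- The six coordinate systems `r₀, …, r₅`. -/
def chart (η : ℂ) (α : Fin 6 → ℂ) : Fin 6 → Fin 4 → PhaseField :=
  let q₁ := coord 0
  let p₁ := coord 1
  let q₂ := coord 2
  let p₂ := coord 3
  let t : PhaseField := algebraMap TimeField PhaseField (time 0)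
  let s : PhaseField := algebraMap TimeField PhaseField (time 1)
  let e : PhaseField := algebraMap ℂ PhaseField η
  let a : Fin 6 → PhaseField := fun i => algebraMap ℂ PhaseField (α i)
  ![blowupChart t s (a 0),
    blowupChart e e (a 1),
    ![1 / q₁, -q₁ * (q₁ * p₁ + a 2), q₂, p₂],
    blowupChart 1 1 (a 3),
    blowupChart 0 0 (a 4),
    ![q₁, p₁, 1 / q₂, -(q₂ * p₂ + a 5) * q₂]]

/-! ### The explicit Hamiltonians -/

/-- The Hamiltonian `H_VI(q, p, t; β₁, β₂, β₃, β₄)`. -/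
def HVI (η : TimeField) (q p : PhaseRing) (t β₁ β₂ β₃ β₄ : TimeField) : PhaseRing :=
  C (1 / (t * (t - 1) * (t - η))) *
    (q * (q - 1) * (q - C η) * (q - C t) * p ^ 2
      + (C (β₁ * (t - η)) * q * (q - 1) + C (2 * β₂) * q * (q - 1) * (q - C η)
          + C (β₃ * (t - 1)) * q * (q - C η) + C (β₄ * t) * (q - 1) * (q - C η)) * p
      + C β₂ * (C ((β₁ + β₂) * (t - η)) + C β₂ * (q - 1) + C (β₃ * (t - 1)) + C (t * β₄)) * q)

/-- The Hamiltonian `H₁` as an expression in `q₁, p₁, q₂, p₂, t, s, α₁, …, α₅`. -/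
def hamExpr (η : TimeField) (q₁ p₁ q₂ p₂ : PhaseRing) (t s α₁ α₂ α₃ α₄ α₅ : TimeField) :
    PhaseRing :=
  HVI η q₁ p₁ t α₁ α₂ α₃ α₄
  + C α₂ * p₂ *
      (C (1 / (t * (t - 1) * (t - s))) *
          (-C ((t - 1) * s) * q₁ + C (t * (s - 1)) * q₂ + C (t - s) * q₁ * q₂)
        + C (1 / (t * (t - 1) * (t - η))) * ((q₁ - C t) * q₂ * (q₂ - 1)))
  + C α₅ * p₁ *
      (C (1 / (t * (t - 1) * (t - s))) *
          (C (t - s) * q₁ * (q₁ - 1) + C (t * (t - 1)) * (q₁ - q₂))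
        + C (1 / (t * (t - 1) * (t - η))) *
          ((q₁ - C t) * (C (t - 1) * q₁ + (q₁ - C t) * q₂)))
  - p₁ * p₂ *
      (C (1 / (t * (t - 1) * (t - s))) *
          (C (t - 1) * (C s * q₁ ^ 2 + C t * q₂ ^ 2) - C (t - s) * q₂ * (q₁ ^ 2 + C t)
            - C (2 * t * (s - 1)) * q₁ * q₂)
        - C (1 / (t * (t - 1) * (t - η))) * ((q₁ - C t) ^ 2 * q₂ * (q₂ - 1)))
  + C (α₂ * α₅ / (t * (t - 1) * (t - η))) *
      (C (2 * t) * q₁ - q₁ - C t * q₂ + q₁ * q₂ - C η * q₁)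

/-- The Hamiltonian `H₁`. -/
def ham₁ (η : ℂ) (α : Fin 6 → ℂ) : PhaseRing :=
  let a : Fin 6 → TimeField := fun i => algebraMap ℂ TimeField (α i)
  hamExpr (algebraMap ℂ TimeField η) (X 0) (X 1) (X 2) (X 3) (time 0) (time 1)
    (a 1) (a 2) (a 3) (a 4) (a 5)

/-- The Hamiltonian `H₂ = π(H₁)`, where `π` exchanges `(q₁, p₁)` with `(q₂, p₂)`, `t` with `s` and
`α₂` with `α₅`. -/
def ham₂ (η : ℂ) (α : Fin 6 → ℂ) : PhaseRing :=
  let a : Fin 6 → TimeField := fun i => algebraMap ℂ TimeField (α i)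
  hamExpr (algebraMap ℂ TimeField η) (X 2) (X 3) (X 0) (X 1) (time 1) (time 0)
    (a 1) (a 5) (a 3) (a 4) (a 2)

end Garnier

end

/-! The chart conditions are statements about poles. For a fixed centre a blow-up chart is
canonical, and a centre moving with velocity (u, v) adds -u p₁ - v p₂ to the Hamiltonian. So dx/dt
is the y-derivative of F = H - u p₁ - v p₂. In the charts at infinity the momentum equation gives,
up to sign, the derivative of H with respect to 1/q. Along a curve on which the other three chart
coordinates are constant, F is a Laurent polynomial whose derivative is polynomial. In
characteristic zero F then has no pole. The hypotheses thus become linear conditions on the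
coefficients of H.

In a blow-up chart p₁ = 1/y and p₂ = w/y, so the part of degree n in the momenta has a pole of order
n. For n ≥ 3 each of its coefficients, a polynomial of degree at most 3 in q₁, q₂, must vanish to
second order at (t, s), (η, η), (1, 1) and (0, 0). A cubic singular at three points of the diagonal
contains the diagonal twice, and the remaining linear factor dies at (t, s) (`cubic_eq_zero`).
Descending from 6, H is at most quadratic in the momenta (`momentumDegreeLE_two`). The charts at
infinity then reduce H to the shape `quadHam` (`eq_quadHam`), and each centre imposes the seven
equations `PointEq`.

Write Ĥ₁, Ĥ₂ for the explicit Hamiltonians and σ for α₀ + α₁ + 2α₂ + α₃ + α₄ + 2α₅. For arbitrary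
parameters Ĥ₁ and Ĥ₂ solve these equations with the centre (t, s) moving at velocity (σ, 0) and (0,
σ) respectively. A solution without q₁⁴p₁² and q₂⁴p₂² terms is constant and has velocity zero
(`params_eq_zero`). Hence H = κ Ĥ₁ + κ' Ĥ₂ + e, with velocity (κσ, κ'σ)
(`eq_combination_of_regular`). The true velocity is (1, 0) for H₁ and (0, 1) for H₂. So σ = 1 forces
H₁ and H₂ up to constants; conversely, if H₁ has the vector field of Ĥ₁, then κ = 1 and σ = 1. -/

noncomputable section

namespace Garnier

/-! ### Values of rational functions at points -/

/-- The rational function `f` is defined at the point `c` and takes the value `v` there. -/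
def HasValue (c : Fin 4 → TimeField) (f : PhaseField) (v : TimeField) : Prop :=
  ∃ A B : PhaseRing, eval c B ≠ 0 ∧ f * algebraMap PhaseRing PhaseField B =
    algebraMap PhaseRing PhaseField A ∧ v * eval c B = eval c A

namespace HasValue

variable {c : Fin 4 → TimeField} {f g : PhaseField} {v w : TimeField}

lemma of_polynomial (c : Fin 4 → TimeField) (A : PhaseRing) :
    HasValue c (algebraMap PhaseRing PhaseField A) (eval c A) :=
  ⟨A, 1, by simp, by simp, by simp⟩

lemma add (hf : HasValue c f v) (hg : HasValue c g w) : HasValue c (f + g) (v + w) := by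
  obtain ⟨A, B, hB, h₁, h₂⟩ := hf
  obtain ⟨A', B', hB', h₁', h₂'⟩ := hg
  refine ⟨A * B' + A' * B, B * B', ?_, ?_, ?_⟩
  · rw [map_mul]
    exact mul_ne_zero hB hB'
  · simp only [map_add, map_mul, ← h₁, ← h₁']
    ring
  · simp only [map_add, map_mul, ← h₂, ← h₂']
    ring

lemma mul (hf : HasValue c f v) (hg : HasValue c g w) : HasValue c (f * g) (v * w) := by
  obtain ⟨A, B, hB, h₁, h₂⟩ := hf
  obtain ⟨A', B', hB', h₁', h₂'⟩ := hg
  refine ⟨A * A', B * B', ?_, ?_, ?_⟩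
  · rw [map_mul]
    exact mul_ne_zero hB hB'
  · simp only [map_mul, ← h₁, ← h₁']
    ring
  · simp only [map_mul, ← h₂, ← h₂']
    ring

lemma one_div (hf : HasValue c f v) (hv : v ≠ 0) : HasValue c (1 / f) (1 / v) := by
  obtain ⟨A, B, hB, h₁, h₂⟩ := hf
  have hA : eval c A ≠ 0 := by
    rw [← h₂]
    exact mul_ne_zero hv hB
  have hA' : (algebraMap PhaseRing PhaseField A) ≠ 0 := by
    rw [Ne, FaithfulSMul.algebraMap_eq_zero_iff]
    rintro rfl
    simp at hA
  have hf : f ≠ 0 := by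
    rintro rfl
    rw [zero_mul] at h₁
    exact hA' h₁.symm
  refine ⟨B, A, hA, ?_, ?_⟩
  · rw [← h₁]
    field_simp
  · rw [← h₂]
    field_simp

lemma div (hf : HasValue c f v) (hg : HasValue c g w) (hw : w ≠ 0) :
    HasValue c (f / g) (v / w) := by
  rw [div_eq_mul_one_div f, div_eq_mul_one_div v]
  exact hf.mul (hg.one_div hw)

/-- Turns an identity in the function field into identities in `TimeField` at each point where both
sides are defined. Cross-multiplication removes the denominators, which do not vanish at the point.
-/
lemma unique (hf : HasValue c f v) (hf' : HasValue c f w) : v = w := by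
  obtain ⟨A, B, hB, h₁, h₂⟩ := hf
  obtain ⟨A', B', hB', h₁', h₂'⟩ := hf'
  have h : A * B' = A' * B := by
    apply FaithfulSMul.algebraMap_injective PhaseRing PhaseField
    rw [map_mul, map_mul, ← h₁, ← h₁']
    ring
  have h' := congrArg (eval c) h
  rw [map_mul, map_mul, ← h₂, ← h₂'] at h'
  have hBB : eval c B * eval c B' ≠ 0 := mul_ne_zero hB hB'
  apply mul_right_cancel₀ hBB
  linear_combination h'

lemma aeval {r : Fin 4 → PhaseField} {v : Fin 4 → TimeField} (h : ∀ i, HasValue c (r i) (v i))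
    (G : PhaseRing) : HasValue c (MvPolynomial.aeval r G) (eval v G) := by
  induction G using MvPolynomial.induction_on with
  | C k =>
    have := HasValue.of_polynomial c (C k)
    rw [eval_C] at this
    rwa [aeval_C, eval_C, IsScalarTower.algebraMap_apply TimeField PhaseRing PhaseField,
      MvPolynomial.algebraMap_eq]
  | add p q hp hq =>
    rw [map_add, map_add]
    exact hp.add hq
  | mul_X p i hp =>
    rw [map_mul, map_mul, aeval_X, eval_X]
    exact hp.mul (h i)

end HasValue

/-! ### Poles along curves -/

section Curve

variable {K : Type*} [Field K]

/-- The chain rule. Dual numbers allow curves with entries such as 1/y to be differentiated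
pointwise at y ≠ 0. -/
lemma aeval_dual {σ : Type*} [Fintype σ] (c c' : σ → K) (F : MvPolynomial σ K) :
    aeval (fun i => (TrivSqZeroExt.inl (c i) + TrivSqZeroExt.inr (c' i) : DualNumber K)) F =
      TrivSqZeroExt.inl (eval c F) + TrivSqZeroExt.inr (∑ i, c' i * eval c (pderiv i F)) := by
  classical
  induction F using MvPolynomial.induction_on with
  | C k =>
    rw [aeval_C, TrivSqZeroExt.algebraMap_eq_inl]
    ext <;> simp
  | add p q hp hq =>
    rw [map_add, hp, hq]
    ext
    · simp
    · simp [mul_add, Finset.sum_add_distrib]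
  | mul_X p j hp =>
    rw [map_mul, hp, aeval_X]
    ext
    · simp
    · simp only [TrivSqZeroExt.snd_mul, TrivSqZeroExt.fst_add, TrivSqZeroExt.fst_inl,
        TrivSqZeroExt.fst_inr, TrivSqZeroExt.snd_add, TrivSqZeroExt.snd_inl, TrivSqZeroExt.snd_inr,
        add_zero, zero_add, smul_eq_mul, MulOpposite.smul_eq_mul_unop, MulOpposite.unop_op,
        pderiv_mul, map_add, map_mul, eval_X, pderiv_X, Pi.single_apply, mul_add,
        Finset.sum_add_distrib]
      rw [mul_zero, mul_zero, add_zero, zero_add, Finset.sum_mul]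
      refine congrArg₂ _ ?_ ?_
      · exact Finset.sum_congr rfl fun i _ => by ring
      · simp [apply_ite, mul_comm]

lemma polynomial_aeval_dual (y : K) (Q : Polynomial K) :
    Polynomial.aeval (TrivSqZeroExt.inl y + TrivSqZeroExt.inr 1 : DualNumber K) Q =
      TrivSqZeroExt.inl (Q.eval y) + TrivSqZeroExt.inr (Q.derivative.eval y) := by
  induction Q using Polynomial.induction_on' with
  | add p q hp hq =>
    rw [map_add, hp, hq]
    ext <;> simp
  | monomial n a =>
    rw [Polynomial.aeval_monomial, TrivSqZeroExt.algebraMap_eq_inl]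
    ext
    · simp
    · simp [TrivSqZeroExt.snd_pow, Polynomial.derivative_monomial]
      ring

lemma dual_pow (y : K) (n : ℕ) : (TrivSqZeroExt.inl y + TrivSqZeroExt.inr 1 : DualNumber K) ^ n =
    TrivSqZeroExt.inl (y ^ n) + TrivSqZeroExt.inr (n * y ^ (n - 1)) := by
  simpa [Polynomial.derivative_X_pow] using polynomial_aeval_dual y (Polynomial.X ^ n)

/-- The left side is y ^ (n + 1) times the derivative of Q / y ^ n. Its i-th coefficient is (i - n)
times that of Q, while the right side starts in degree n + 1. -/
lemma coeff_eq_zero_of_derivative [CharZero K] (n : ℕ) (Q P : Polynomial K)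
    (h : ∀ y ≠ 0, y * Q.derivative.eval y - n * Q.eval y = y ^ (n + 1) * P.eval y)
    (i : ℕ) (hi : i < n) : Q.coeff i = 0 := by
  have h' : Polynomial.X * Q.derivative - Polynomial.C (n : K) * Q = Polynomial.X ^ (n + 1) * P := by
    refine Polynomial.eq_of_infinite_eval_eq _ _ ((Set.finite_singleton (0 : K)).infinite_compl.mono
      fun y hy => ?_)
    simpa using h y hy
  have hc := congrArg (fun p => Polynomial.coeff p i) h'
  simp only [Polynomial.coeff_sub, Polynomial.coeff_C_mul, Polynomial.coeff_X_pow_mul',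
    show ¬ n + 1 ≤ i by omega, if_false] at hc
  have hX : (Polynomial.X * Q.derivative).coeff i = i * Q.coeff i := by
    cases i with
    | zero => simp
    | succ i =>
      rw [Polynomial.coeff_X_mul, Polynomial.coeff_derivative]
      push_cast
      ring
  rw [hX, ← sub_mul] at hc
  refine (mul_eq_zero.mp hc).resolve_left (sub_ne_zero.mpr ?_)
  exact_mod_cast hi.ne

/-- If the derivative of `F` along a curve is polynomial in the parameter, then `F` has no pole. -/
lemma coeff_eq_zero_of_curve [CharZero K] {σ : Type*} [Fintype σ] (F : MvPolynomial σ K) (n : ℕ)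
    (Q P : Polynomial K) (c c' : K → σ → K)
    (hQ : ∀ y ≠ 0, Polynomial.aeval (TrivSqZeroExt.inl y + TrivSqZeroExt.inr 1 : DualNumber K) Q =
      (TrivSqZeroExt.inl y + TrivSqZeroExt.inr 1) ^ n *
        aeval (fun i => (TrivSqZeroExt.inl (c y i) + TrivSqZeroExt.inr (c' y i) : DualNumber K)) F)
    (hP : ∀ y ≠ 0, ∑ i, c' y i * eval (c y) (pderiv i F) = P.eval y)
    (i : ℕ) (hi : i < n) : Q.coeff i = 0 := by
  refine coeff_eq_zero_of_derivative n Q P (fun y hy => ?_) i hi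
  have h := hQ y hy
  rw [polynomial_aeval_dual, dual_pow, aeval_dual, hP y hy] at h
  have h₁ := congrArg TrivSqZeroExt.fst h
  have h₂ := congrArg TrivSqZeroExt.snd h
  simp at h₁ h₂
  rw [h₁, h₂]
  -- Since i < n, the exponent n - 1 coming from `dual_pow` is not truncated.
  obtain ⟨m, rfl⟩ : ∃ m, n = m + 1 := ⟨n - 1, by omega⟩
  simp
  ring

end Curve

/-! ### Coefficients of polynomials on the phase space -/

section Coefficients

variable {K : Type*} [Field K]

/-- The exponent of `X₀ ^ i * X₁ ^ j * X₂ ^ k * X₃ ^ l`. -/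
def expo (i j k l : ℕ) : Fin 4 →₀ ℕ := Finsupp.equivFunOnFinite.symm ![i, j, k, l]

/-- The coefficient of `q₁ ^ i * p₁ ^ j * q₂ ^ k * p₂ ^ l`. -/
def coef (F : MvPolynomial (Fin 4) K) (i j k l : ℕ) : K := coeff (expo i j k l) F

lemma coef_eq_zero {F : MvPolynomial (Fin 4) K} {n : ℕ} (hF : F.totalDegree ≤ n) {i j k l : ℕ}
    (h : n < i + j + k + l) : coef F i j k l = 0 := by
  refine coeff_eq_zero_of_totalDegree_lt (lt_of_le_of_lt hF ?_)
  rw [← Finsupp.degree_apply, Finsupp.degree_eq_sum]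
  simpa [expo, Fin.sum_univ_four] using h

lemma aeval_eq_sum_coef {F : MvPolynomial (Fin 4) K} {n : ℕ} (hF : F.totalDegree ≤ n)
    {A : Type*} [CommRing A] [Algebra K A] (c : Fin 4 → A) :
    aeval c F = ∑ j ∈ Finset.range (n + 1), ∑ l ∈ Finset.range (n + 1),
      ∑ i ∈ Finset.range (n + 1), ∑ k ∈ Finset.range (n + 1),
        algebraMap K A (coef F i j k l) * (c 0 ^ i * c 1 ^ j * c 2 ^ k * c 3 ^ l) := by
  have hsum : aeval c F = ∑ m ∈ F.support, algebraMap K A (coeff m F) *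
      (c 0 ^ m 0 * c 1 ^ m 1 * c 2 ^ m 2 * c 3 ^ m 3) := by
    rw [aeval_def, eval₂_eq']
    simp [Fin.prod_univ_four]
  rw [hsum]
  simp only [← Finset.sum_product']
  symm
  -- The box of exponents is larger than the support, so only nonzero terms are matched. Quadruples
  -- are ordered (j, l, i, k), momenta first.
  refine Finset.sum_bij_ne_zero (fun p _ _ => expo p.2.2.1 p.1 p.2.2.2 p.2.1) ?_ ?_ ?_ ?_
  · rintro ⟨j, l, i, k⟩ _ h
    rw [mem_support_iff]
    intro h'
    exact h (by simp [coef, h'])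
  · rintro ⟨j, l, i, k⟩ _ _ ⟨j', l', i', k'⟩ _ _ h
    have h' := congrArg (fun m : Fin 4 →₀ ℕ => (m 0, m 1, m 2, m 3)) h
    simp [expo] at h'
    simp [h']
  · intro m hm hne
    have hdeg := (le_totalDegree hm).trans hF
    rw [Finsupp.sum_fintype _ _ fun _ => rfl, Fin.sum_univ_four] at hdeg
    have hexpo : expo (m 0) (m 1) (m 2) (m 3) = m := by
      ext i
      fin_cases i <;> rfl
    refine ⟨(m 1, m 3, m 0, m 2), ?_, ?_, hexpo⟩
    · simp only [Finset.mem_product, Finset.mem_range]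
      omega
    · simpa [coef, hexpo] using hne
  · rintro ⟨j, l, i, k⟩ _ _
    simp [expo, coef]

/-- The coefficient of `p₁ ^ j * p₂ ^ l`, as a polynomial in `q₁, q₂`, for polynomials of total
degree at most `6`. -/
def momentum (F : MvPolynomial (Fin 4) K) (j l : ℕ) : MvPolynomial (Fin 2) K :=
  ∑ i ∈ Finset.range 7, ∑ k ∈ Finset.range 7, C (coef F i j k l) * (X 0 ^ i * X 1 ^ k)

lemma aeval_eq_sum_momentum {F : MvPolynomial (Fin 4) K} (hF : F.totalDegree ≤ 6)
    {A : Type*} [CommRing A] [Algebra K A] (c : Fin 4 → A) :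
    aeval c F = ∑ j ∈ Finset.range 7, ∑ l ∈ Finset.range 7,
      aeval ![c 0, c 2] (momentum F j l) * (c 1 ^ j * c 3 ^ l) := by
  rw [aeval_eq_sum_coef hF]
  refine Finset.sum_congr rfl fun j _ => Finset.sum_congr rfl fun l _ => ?_
  simp only [momentum, map_sum, map_mul, map_pow, aeval_C, aeval_X, Finset.sum_mul]
  refine Finset.sum_congr rfl fun i _ => Finset.sum_congr rfl fun k _ => ?_
  simp
  ring

lemma coeff_sum_sum (u : ℕ → ℕ → K) (n : ℕ) (m : Fin 2 →₀ ℕ) :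
    coeff m (∑ i ∈ Finset.range n, ∑ k ∈ Finset.range n,
      C (u i k) * (X 0 ^ i * X 1 ^ k) : MvPolynomial (Fin 2) K) =
      if m 0 < n ∧ m 1 < n then u (m 0) (m 1) else 0 := by
  have h : ∀ i k : ℕ, coeff m (C (u i k) * (X 0 ^ i * X 1 ^ k) : MvPolynomial (Fin 2) K) =
      if i = m 0 then (if k = m 1 then u i k else 0) else 0 := by
    intro i k
    rw [coeff_C_mul, X_pow_eq_monomial, X_pow_eq_monomial, monomial_mul, coeff_monomial]
    have : Finsupp.single 0 i + Finsupp.single 1 k = m ↔ i = m 0 ∧ k = m 1 := by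
      constructor
      · rintro rfl
        simp
      · rintro ⟨rfl, rfl⟩
        ext i
        fin_cases i <;> simp
    simp only [this]
    split_ifs <;> simp_all
  simp only [coeff_sum, h]
  simp [← Finset.mem_range, ite_and]

lemma coeff_momentum (F : MvPolynomial (Fin 4) K) (j l : ℕ) (m : Fin 2 →₀ ℕ) :
    coeff m (momentum F j l) = if m 0 < 7 ∧ m 1 < 7 then coef F (m 0) j (m 1) l else 0 :=
  coeff_sum_sum (fun i k => coef F i j k l) 7 m

lemma coef_eq_zero_of_momentum {F : MvPolynomial (Fin 4) K} (hF : F.totalDegree ≤ 6) {j l : ℕ}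
    (h : momentum F j l = 0) (i k : ℕ) : coef F i j k l = 0 := by
  by_cases hik : i < 7 ∧ k < 7
  · have := coeff_momentum F j l (Finsupp.equivFunOnFinite.symm ![i, k])
    simpa [h, hik] using this.symm
  · exact coef_eq_zero hF (by omega)

lemma totalDegree_momentum_le {F : MvPolynomial (Fin 4) K} (hF : F.totalDegree ≤ 6) (j l : ℕ) :
    (momentum F j l).totalDegree ≤ 6 - (j + l) := by
  refine Finset.sup_le fun m hm => ?_
  rw [mem_support_iff, coeff_momentum] at hm
  rw [Finsupp.sum_fintype _ _ fun _ => rfl, Fin.sum_univ_two]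
  by_contra hlt
  apply hm
  split_ifs
  · exact coef_eq_zero hF (by omega)
  · rfl

lemma momentum_sub (F G : MvPolynomial (Fin 4) K) (j l : ℕ) :
    momentum (F - G) j l = momentum F j l - momentum G j l := by
  simp [momentum, coef, coeff_sub, sub_mul, Finset.sum_sub_distrib]

lemma coef_C_mul_X (u : K) (m : Fin 4) (i j k l : ℕ) :
    coef (C u * X m) i j k l =
      if ![i, j, k, l] = Pi.single m 1 then u else 0 := by
  have : Finsupp.single m 1 = expo i j k l ↔ ![i, j, k, l] = Pi.single m 1 := by
    rw [expo, Equiv.eq_symm_apply, eq_comm]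
    simp [Finsupp.equivFunOnFinite, Finsupp.single_eq_pi_single]
  simp only [coef, coeff_C_mul, coeff_X, this]
  simp

lemma momentum_C_mul_X_one (u : K) (j l : ℕ) :
    momentum (C u * X 1) j l = if j = 1 ∧ l = 0 then C u else 0 := by
  have h (i k : ℕ) : coef (C u * X 1) i j k l =
      if i = 0 then (if k = 0 then (if j = 1 ∧ l = 0 then u else 0) else 0) else 0 := by
    rw [coef_C_mul_X]
    simp only [← ite_and]
    congr 1
    simp [funext_iff, Fin.forall_fin_succ, Pi.single_apply]
    tauto
  simp only [momentum, h]
  split_ifs <;> simp [Finset.sum_range_succ]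

lemma momentum_C_mul_X_three (u : K) (j l : ℕ) :
    momentum (C u * X 3) j l = if j = 0 ∧ l = 1 then C u else 0 := by
  have h (i k : ℕ) : coef (C u * X 3) i j k l =
      if i = 0 then (if k = 0 then (if j = 0 ∧ l = 1 then u else 0) else 0) else 0 := by
    rw [coef_C_mul_X]
    simp only [← ite_and]
    congr 1
    simp [funext_iff, Fin.forall_fin_succ, Pi.single_apply]
    tauto
  simp only [momentum, h]
  split_ifs <;> simp [Finset.sum_range_succ]

lemma totalDegree_sub_le {F : MvPolynomial (Fin 4) K} (hF : F.totalDegree ≤ 6) (u u' : K) :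
    (F - C u * X 1 - C u' * X 3).totalDegree ≤ 6 := by
  have h (v : K) (m : Fin 4) : (C v * X m : MvPolynomial (Fin 4) K).totalDegree ≤ 6 :=
    (totalDegree_mul _ _).trans (by simp)
  exact (totalDegree_sub _ _).trans (max_le ((totalDegree_sub _ _).trans (max_le hF (h u 1)))
    (h u' 3))

/-! ### Plane cubics singular at the four centres -/

lemma eq_sum_of_totalDegree_le {f : MvPolynomial (Fin 2) K} {n : ℕ} (hf : f.totalDegree ≤ n) :
    ∃ u : ℕ → ℕ → K, (∀ i k, n < i + k → u i k = 0) ∧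
      f = ∑ i ∈ Finset.range (n + 1), ∑ k ∈ Finset.range (n + 1),
        C (u i k) * (X 0 ^ i * X 1 ^ k) := by
  have hz : ∀ m : Fin 2 →₀ ℕ, n < m 0 + m 1 → coeff m f = 0 := by
    intro m hm
    refine coeff_eq_zero_of_totalDegree_lt (lt_of_le_of_lt hf ?_)
    rw [← Finsupp.degree_apply, Finsupp.degree_eq_sum, Fin.sum_univ_two]
    exact hm
  refine ⟨fun i k => coeff (Finsupp.equivFunOnFinite.symm ![i, k]) f, fun i k h => hz _ h, ?_⟩
  ext m
  rw [coeff_sum_sum]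
  split_ifs with h
  · congr
    ext i
    fin_cases i <;> rfl
  · exact hz m (by omega)

/-- A cubic in the plane which is singular at three points of the diagonal and at one point outside
of it is zero. -/
lemma cubic_eq_zero [CharZero K] {f : MvPolynomial (Fin 2) K} (hf : f.totalDegree ≤ 3)
    {η t s : K} (hη₀ : η ≠ 0) (hη₁ : η ≠ 1) (hts : t ≠ s)
    (h : ∀ v ∈ ({![t, s], ![η, η], ![1, 1], ![0, 0]} : Set (Fin 2 → K)),
      eval v f = 0 ∧ eval v (pderiv 0 f) = 0 ∧ eval v (pderiv 1 f) = 0) : f = 0 := by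
  obtain ⟨u, hu, rfl⟩ := eq_sum_of_totalDegree_le hf
  have hu13 := hu 1 3 (by norm_num)
  have hu22 := hu 2 2 (by norm_num)
  have hu31 := hu 3 1 (by norm_num)
  have hu23 := hu 2 3 (by norm_num)
  have hu32 := hu 3 2 (by norm_num)
  have hu33 := hu 3 3 (by norm_num)
  obtain ⟨z₀, z₁, z₂⟩ := h ![0, 0] (by simp)
  obtain ⟨o₀, o₁, o₂⟩ := h ![1, 1] (by simp)
  obtain ⟨e₀, e₁, e₂⟩ := h ![η, η] (by simp)
  obtain ⟨t₀, t₁, t₂⟩ := h ![t, s] (by simp)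
  simp [Finset.sum_range_succ, pderiv_X, hu13, hu22, hu31, hu23, hu32, hu33] at z₀ z₁ z₂
  simp [Finset.sum_range_succ, pderiv_X, hu13, hu22, hu31, hu23, hu32, hu33, z₀, z₁, z₂]
    at o₀ o₁ o₂ e₀ e₁ e₂ t₀ t₁ t₂
  have hη : η - 1 ≠ 0 := sub_ne_zero.mpr hη₁
  have hd : t - s ≠ 0 := sub_ne_zero.mpr hts
  -- These are the leading coefficients of f, ∂₀f and ∂₁f restricted to the diagonal, which have too
  -- many zeros at 0, 1 and η.
  have s₀ : u 3 0 + u 2 1 + u 1 2 + u 0 3 = 0 := by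
    refine (mul_eq_zero.mp (?_ : η ^ 2 * (η - 1) * _ = 0)).resolve_left (by simp [hη₀, hη])
    linear_combination e₀ - η ^ 2 * o₀
  have s₁ : 3 * u 3 0 + 2 * u 2 1 + u 1 2 = 0 := by
    refine (mul_eq_zero.mp (?_ : η * (η - 1) * _ = 0)).resolve_left (by simp [hη₀, hη])
    linear_combination e₁ - η * o₁
  have s₂ : u 2 1 + 2 * u 1 2 + 3 * u 0 3 = 0 := by
    refine (mul_eq_zero.mp (?_ : η * (η - 1) * _ = 0)).resolve_left (by simp [hη₀, hη])
    linear_combination e₂ - η * o₂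
  have c11 : u 1 1 = -2 * u 2 0 := by linear_combination o₁ - s₁
  have c02 : u 0 2 = u 2 0 := by linear_combination o₀ - s₀ - c11
  have c21 : u 2 1 = u 0 3 - 2 * u 3 0 := by linear_combination s₁ - s₀
  have c12 : u 1 2 = u 3 0 - 2 * u 0 3 := by linear_combination s₀ - c21
  simp only [c11, c02, c21, c12] at t₀ t₁ t₂
  -- Now f = (X₀ - X₁)² (u₂₀ + u₃₀ X₀ + u₀₃ X₁). Off the diagonal, the vanishing of f and its
  -- derivatives passes to the linear factor.
  have hL : u 2 0 + u 3 0 * t + u 0 3 * s = 0 := by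
    refine (mul_eq_zero.mp (?_ : (t - s) ^ 2 * _ = 0)).resolve_left (pow_ne_zero 2 hd)
    linear_combination t₀
  have c30 : u 3 0 = 0 := by
    refine (mul_eq_zero.mp (?_ : (t - s) ^ 2 * _ = 0)).resolve_left (pow_ne_zero 2 hd)
    linear_combination t₁ - 2 * (t - s) * hL
  have c03 : u 0 3 = 0 := by
    refine (mul_eq_zero.mp (?_ : (t - s) ^ 2 * _ = 0)).resolve_left (pow_ne_zero 2 hd)
    linear_combination t₂ + 2 * (t - s) * hL
  have c20 : u 2 0 = 0 := by linear_combination hL - t * c30 - s * c03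
  rw [c30, c03] at c21 c12
  rw [c20] at c11 c02
  simp [Finset.sum_range_succ, hu13, hu22, hu31, hu23, hu32, hu33, z₀, z₁, z₂, c30, c03, c20, c21,
    c12, c11, c02]

end Coefficients

/-! ### Regularity in the blow-up charts -/

section Blowup

variable {K : Type*} [Field K]

lemma exists_taylor (f : MvPolynomial (Fin 2) K) (a b : K) :
    ∃ g₁ g₂ g₃ : MvPolynomial (Fin 2) K, f = C (eval ![a, b] f) +
      C (eval ![a, b] (pderiv 0 f)) * (X 0 - C a) + C (eval ![a, b] (pderiv 1 f)) * (X 1 - C b) +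
      (X 0 - C a) ^ 2 * g₁ + (X 0 - C a) * (X 1 - C b) * g₂ + (X 1 - C b) ^ 2 * g₃ := by
  induction f using MvPolynomial.induction_on with
  | C k => exact ⟨0, 0, 0, by simp⟩
  | add p q hp hq =>
    obtain ⟨g₁, g₂, g₃, h⟩ := hp
    obtain ⟨g₁', g₂', g₃', h'⟩ := hq
    refine ⟨g₁ + g₁', g₂ + g₂', g₃ + g₃', ?_⟩
    simp only [map_add]
    linear_combination h + h'
  | mul_X p i hp =>
    obtain ⟨g₁, g₂, g₃, h⟩ := hp
    fin_cases i
    · refine ⟨C (eval ![a, b] (pderiv 0 p)) + g₁ * X 0, C (eval ![a, b] (pderiv 1 p)) + g₂ * X 0,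
        g₃ * X 0, ?_⟩
      simp [pderiv_X]
      linear_combination X 0 * h
    · refine ⟨g₁ * X 1, C (eval ![a, b] (pderiv 0 p)) + g₂ * X 1,
        C (eval ![a, b] (pderiv 1 p)) + g₃ * X 1, ?_⟩
      simp [pderiv_X]
      linear_combination X 1 * h

/-- Restriction of `f` to the parametrized curve `y ↦ (a + y (u - x y), b + y z)`. -/
def restrict (a b u z x : K) : MvPolynomial (Fin 2) K →ₐ[K] Polynomial K :=
  aeval ![Polynomial.C a + Polynomial.X * (Polynomial.C u - Polynomial.C x * Polynomial.X),
    Polynomial.C b + Polynomial.X * Polynomial.C z]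

lemma coeff_zero_restrict (a b u z x : K) (f : MvPolynomial (Fin 2) K) :
    (restrict a b u z x f).coeff 0 = eval ![a, b] f := by
  have h : (Polynomial.aeval (0 : K)).comp (restrict a b u z x) = aeval ![a, b] := by
    ext i
    fin_cases i <;> simp [restrict]
  have h' := congrArg (fun g => g f) h
  simp only [AlgHom.comp_apply, Polynomial.coe_aeval_eq_eval] at h'
  rw [Polynomial.coeff_zero_eq_eval_zero, h', aeval_eq_eval]

/-- The parameter x occurs only in the term -x y² of the first coordinate, so up to order y² it is
felt only through ∂₀f. As ρ does not depend on x, differences in x isolate ∂₀f. -/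
lemma exists_coeff_restrict (f : MvPolynomial (Fin 2) K) (a b u z : K) :
    ∃ ρ : K, ∀ x, (restrict a b u z x f).coeff 1 =
        eval ![a, b] (pderiv 0 f) * u + eval ![a, b] (pderiv 1 f) * z ∧
      (restrict a b u z x f).coeff 2 = -(x * eval ![a, b] (pderiv 0 f)) + ρ := by
  obtain ⟨g₁, g₂, g₃, h⟩ := exists_taylor f a b
  set f₀ := eval ![a, b] f
  set f₁ := eval ![a, b] (pderiv 0 f)
  set f₂ := eval ![a, b] (pderiv 1 f)
  refine ⟨u ^ 2 * eval ![a, b] g₁ + u * z * eval ![a, b] g₂ + z ^ 2 * eval ![a, b] g₃, fun x => ?_⟩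
  set R := restrict a b u z x with hR
  set G : Polynomial K := (Polynomial.C u - Polynomial.C x * Polynomial.X) ^ 2 * R g₁ +
    (Polynomial.C u - Polynomial.C x * Polynomial.X) * Polynomial.C z * R g₂ +
    Polynomial.C z ^ 2 * R g₃ with hG
  have hG0 : G.coeff 0 =
      u ^ 2 * eval ![a, b] g₁ + u * z * eval ![a, b] g₂ + z ^ 2 * eval ![a, b] g₃ := by
    simp [hG, hR, ← coeff_zero_restrict a b u z x, Polynomial.mul_coeff_zero, pow_two]
  have hf : R f = Polynomial.C f₀ + Polynomial.C (f₁ * u + f₂ * z) * Polynomial.X -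
      Polynomial.C (x * f₁) * Polynomial.X ^ 2 + Polynomial.X ^ 2 * G := by
    have hC : ∀ k, R (C k) = Polynomial.C k := fun k => by simp [hR, restrict]
    have h0 : R (X 0) = Polynomial.C a +
      Polynomial.X * (Polynomial.C u - Polynomial.C x * Polynomial.X) := by simp [hR, restrict]
    have h1 : R (X 1) = Polynomial.C b + Polynomial.X * Polynomial.C z := by simp [hR, restrict]
    have := congrArg R h
    simp only [map_add, map_mul, map_sub, map_pow, hC, h0, h1] at this
    rw [this, hG]
    simp only [map_add, map_mul]
    ring
  constructor
  · rw [hf]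
    simp [Polynomial.coeff_X_pow_mul', Polynomial.coeff_X_pow, Polynomial.coeff_C_mul, -map_mul]
  · rw [hf]
    simp [Polynomial.coeff_X_pow, Polynomial.coeff_X_pow_mul', hG0, -map_mul]

/-- Total degree in the momenta at most `n`. -/
def MomentumDegreeLE (F : MvPolynomial (Fin 4) K) (n : ℕ) : Prop :=
  ∀ j l, n < j + l → momentum F j l = 0

/-- The curve on which the coordinates `x, z, w` of a blow-up chart are fixed and `y` varies. -/
def blowupCurve (a b α x z w y : K) : Fin 4 → K :=
  ![a + y * (α - z * w - x * y), 1 / y, b + y * z, w / y]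

/-- The velocity of `blowupCurve`. -/
def blowupVelocity (α x z w y : K) : Fin 4 → K :=
  ![α - z * w - 2 * x * y, -(1 / y ^ 2), z, -(w / y ^ 2)]

/-- The derivative of `F` with respect to the coordinate `y` of the blow-up chart is polynomial. -/
def BlowupRegular (F : MvPolynomial (Fin 4) K) (a b α : K) : Prop :=
  ∀ x z w : K, ∃ P : Polynomial K, ∀ y ≠ 0,
    ∑ i, blowupVelocity α x z w y i * eval (blowupCurve a b α x z w y) (pderiv i F) = P.eval y

/-- `y ^ n * F` along `blowupCurve`, as a polynomial in `y`. -/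
def blowupPullback (F : MvPolynomial (Fin 4) K) (a b α x z w : K) (n : ℕ) : Polynomial K :=
  ∑ j ∈ Finset.range 7, ∑ l ∈ Finset.range 7, if j + l ≤ n then
    Polynomial.X ^ (n - (j + l)) * (Polynomial.C (w ^ l) *
      restrict a b (α - z * w) z x (momentum F j l)) else 0

lemma aeval_blowupPullback {F : MvPolynomial (Fin 4) K} (hF : F.totalDegree ≤ 6)
    {n : ℕ} (hn : MomentumDegreeLE F n) (a b α x z w : K) {A : Type*} [CommRing A] [Algebra K A]
    {Y Y' : A} (hY : Y * Y' = 1) {c : Fin 4 → A}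
    (hc₀ : c 0 = algebraMap K A a + Y * (algebraMap K A (α - z * w) - algebraMap K A x * Y))
    (hc₁ : c 1 = Y') (hc₂ : c 2 = algebraMap K A b + Y * algebraMap K A z)
    (hc₃ : c 3 = algebraMap K A w * Y') :
    Polynomial.aeval Y (blowupPullback F a b α x z w n) = Y ^ n * aeval c F := by
  have hR : ∀ f, Polynomial.aeval Y (restrict a b (α - z * w) z x f) = aeval ![c 0, c 2] f := by
    intro f
    have h : (Polynomial.aeval Y).comp (restrict a b (α - z * w) z x) = aeval ![c 0, c 2] := by
      ext i
      fin_cases i <;> simp [restrict, hc₀, hc₂, mul_comm (algebraMap K A z)]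
    exact congrArg (fun g => g f) h
  rw [aeval_eq_sum_momentum hF, blowupPullback, map_sum, Finset.mul_sum]
  refine Finset.sum_congr rfl fun j _ => ?_
  rw [map_sum, Finset.mul_sum]
  refine Finset.sum_congr rfl fun l _ => ?_
  split_ifs with h
  · obtain ⟨k, rfl⟩ := Nat.exists_eq_add_of_le h
    have hpow : Y ^ (j + l) * Y' ^ (j + l) = 1 := by rw [← mul_pow, hY, one_pow]
    simp only [map_mul, map_pow, Polynomial.aeval_X, Polynomial.aeval_C, hR, hc₁, hc₃,
      Nat.add_sub_cancel_left]
    linear_combination -(Y ^ k * algebraMap K A w ^ l * aeval ![c 0, c 2] (momentum F j l)) * hpow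
  · rw [hn j l (by omega)]
    simp

lemma coeff_blowupPullback_eq_zero [CharZero K] {F : MvPolynomial (Fin 4) K}
    (hF : F.totalDegree ≤ 6) {n : ℕ} (hn : MomentumDegreeLE F n) {a b α : K}
    (h : BlowupRegular F a b α) (x z w : K) {i : ℕ} (hi : i < n) :
    (blowupPullback F a b α x z w n).coeff i = 0 := by
  obtain ⟨P, hP⟩ := h x z w
  refine coeff_eq_zero_of_curve F n _ P (blowupCurve a b α x z w) (blowupVelocity α x z w)
    (fun y hy => ?_) hP i hi
  refine aeval_blowupPullback (Y' := TrivSqZeroExt.inl (1 / y) + TrivSqZeroExt.inr (-(1 / y ^ 2)))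
    hF hn a b α x z w ?_ ?_ ?_ ?_ ?_
  · ext
    · simp [hy]
    · simp
      field_simp
      ring
  · ext
    · simp [blowupCurve, TrivSqZeroExt.algebraMap_eq_inl]
    · simp [blowupVelocity, TrivSqZeroExt.algebraMap_eq_inl]
      ring
  · rfl
  · ext
    · simp [blowupCurve, TrivSqZeroExt.algebraMap_eq_inl]
    · simp [blowupVelocity, TrivSqZeroExt.algebraMap_eq_inl]
  · ext
    · simp [blowupCurve, TrivSqZeroExt.algebraMap_eq_inl]
      ring
    · simp [blowupVelocity, TrivSqZeroExt.algebraMap_eq_inl]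
      ring

lemma coeff_blowupPullback (F : MvPolynomial (Fin 4) K) (a b α x z w : K) (n m : ℕ) :
    (blowupPullback F a b α x z w n).coeff m =
      ∑ l ∈ Finset.range 7, w ^ l * ∑ j ∈ Finset.range 7, if j + l ≤ n ∧ n - (j + l) ≤ m then
        (restrict a b (α - z * w) z x (momentum F j l)).coeff (m - (n - (j + l))) else 0 := by
  rw [blowupPullback, Finset.sum_comm, Polynomial.finsetSum_coeff]
  refine Finset.sum_congr rfl fun l _ => ?_
  rw [Finset.mul_sum, Polynomial.finsetSum_coeff]
  refine Finset.sum_congr rfl fun j _ => ?_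
  by_cases h : j + l ≤ n
  · simp [h, Polynomial.coeff_X_pow_mul', Polynomial.coeff_C_mul, -map_pow]
  · simp [h]

lemma eq_zero_of_forall_sum_pow [CharZero K] {u : ℕ → K} {n : ℕ}
    (h : ∀ w : K, ∑ l ∈ Finset.range n, w ^ l * u l = 0) {l : ℕ} (hl : l < n) : u l = 0 := by
  have hp : ∑ l ∈ Finset.range n, Polynomial.C (u l) * Polynomial.X ^ l = 0 :=
    Polynomial.funext fun w => by
      simpa only [Polynomial.eval_finsetSum, Polynomial.eval_mul, Polynomial.eval_C,
        Polynomial.eval_pow, Polynomial.eval_X, Polynomial.eval_zero, mul_comm] using h w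
  have := congrArg (fun p => Polynomial.coeff p l) hp
  simpa [Polynomial.finsetSum_coeff, Polynomial.coeff_X_pow, hl] using this

lemma sum_range_ite_add_eq {n l : ℕ} (hn : n ≤ 6) (hl : l ≤ n) (u : ℕ → K) :
    (∑ j ∈ Finset.range 7, if j + l = n then u j else 0) = u (n - l) := by
  rw [Finset.sum_eq_single (n - l)]
  · rw [if_pos (by omega)]
  · intro j _ hj
    rw [if_neg (by omega)]
  · intro hj
    exact absurd (Finset.mem_range.mpr (by omega)) hj

lemma coeff_one_restrict (a b u z x : K) (f : MvPolynomial (Fin 2) K) :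
    (restrict a b u z x f).coeff 1 =
      eval ![a, b] (pderiv 0 f) * u + eval ![a, b] (pderiv 1 f) * z :=
  ((exists_coeff_restrict f a b u z).choose_spec x).1

/-- The part of `F` of highest degree in the momenta is singular at the centre of a blow-up. -/
lemma eval_momentum_eq_zero [CharZero K] {F : MvPolynomial (Fin 4) K}
    (hF : F.totalDegree ≤ 6) {n : ℕ} (hn : MomentumDegreeLE F n) (hn3 : 3 ≤ n) (hn6 : n ≤ 6)
    {a b α : K} (h : BlowupRegular F a b α) :
    ∀ j l, j + l = n → eval ![a, b] (momentum F j l) = 0 ∧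
      eval ![a, b] (pderiv 0 (momentum F j l)) = 0 ∧
      eval ![a, b] (pderiv 1 (momentum F j l)) = 0 := by
  have key (x z w : K) {i : ℕ} (hi : i < n) :=
    (coeff_blowupPullback F a b α x z w n i).symm.trans
      (coeff_blowupPullback_eq_zero hF hn h x z w hi)
  have top (u : ℕ → ℕ → K) (hu : ∀ w : K, ∑ l ∈ Finset.range 7, w ^ l *
      ∑ j ∈ Finset.range 7, (if j + l = n then u j l else 0) = 0) : ∀ j l, j + l = n → u j l = 0 := by
    intro j l hjl
    have := eq_zero_of_forall_sum_pow hu (show l < 7 by omega)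
    rw [sum_range_ite_add_eq hn6 (by omega)] at this
    rwa [show n - l = j by omega] at this
  have h₀ : ∀ j l, j + l = n → eval ![a, b] (momentum F j l) = 0 := by
    refine top (fun j l => eval ![a, b] (momentum F j l)) fun w => ?_
    refine Eq.trans ?_ (key 0 0 w (i := 0) (by omega))
    refine Finset.sum_congr rfl fun l _ => congrArg _ (Finset.sum_congr rfl fun j _ => ?_)
    by_cases hjn : j + l = n
    · simp [hjn, coeff_zero_restrict]
    · rw [if_neg hjn, if_neg (by omega)]
  -- The parts of momentum degree n - 1 and n - 2 enter the coefficient of y² through the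
  -- coefficients 1 and 0 of their restrictions, which are independent of x. The difference between
  -- x = 0 and x = 1 leaves only ∂₀ of the top part. Here 2 < n is needed.
  have h₁ : ∀ j l, j + l = n → eval ![a, b] (pderiv 0 (momentum F j l)) = 0 := by
    refine top (fun j l => eval ![a, b] (pderiv 0 (momentum F j l))) fun w => ?_
    refine Eq.trans ?_ (sub_eq_zero.mpr ((key 0 0 w (i := 2) (by omega)).trans
      (key 1 0 w (i := 2) (by omega)).symm))
    rw [← Finset.sum_sub_distrib]
    refine Finset.sum_congr rfl fun l _ => ?_
    rw [← mul_sub, ← Finset.sum_sub_distrib]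
    refine congrArg _ (Finset.sum_congr rfl fun j _ => ?_)
    obtain ⟨ρ, hρ⟩ := exists_coeff_restrict (momentum F j l) a b (α - 0 * w) 0
    by_cases hjn : j + l = n
    · rw [if_pos hjn, hjn, if_pos (by omega), if_pos (by omega), Nat.sub_self, Nat.sub_zero,
        (hρ 0).2, (hρ 1).2]
      ring
    · rw [if_neg hjn]
      split_ifs with hc
      · obtain hc' | hc' : 2 - (n - (j + l)) = 0 ∨ 2 - (n - (j + l)) = 1 := by omega
        · rw [hc', coeff_zero_restrict, coeff_zero_restrict, sub_self]
        · rw [hc', (hρ 0).1, (hρ 1).1, sub_self]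
      · rw [sub_self]
  -- In the coefficient of y the part of degree n - 1 contributes only its value at the centre,
  -- which cancels between z = 1 and z = 0. The first coordinate also moves with z, through α - z w,
  -- but its factor ∂₀ vanishes by `h₁`.
  have h₂ : ∀ j l, j + l = n → eval ![a, b] (pderiv 1 (momentum F j l)) = 0 := by
    refine top (fun j l => eval ![a, b] (pderiv 1 (momentum F j l))) fun w => ?_
    refine Eq.trans ?_ (sub_eq_zero.mpr ((key 0 1 w (i := 1) (by omega)).trans
      (key 0 0 w (i := 1) (by omega)).symm))
    rw [← Finset.sum_sub_distrib]
    refine Finset.sum_congr rfl fun l _ => ?_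
    rw [← mul_sub, ← Finset.sum_sub_distrib]
    refine congrArg _ (Finset.sum_congr rfl fun j _ => ?_)
    by_cases hjn : j + l = n
    · rw [if_pos hjn, hjn, if_pos (by omega), if_pos (by omega), Nat.sub_self, Nat.sub_zero,
        coeff_one_restrict, coeff_one_restrict, h₁ j l hjn]
      ring
    · rw [if_neg hjn]
      split_ifs with hc
      · rw [show 1 - (n - (j + l)) = 0 by omega, coeff_zero_restrict, coeff_zero_restrict, sub_self]
      · rw [sub_self]
  exact fun j l hjl => ⟨h₀ j l hjl, h₁ j l hjl, h₂ j l hjl⟩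

/-- The conditions which a blow-up imposes on a polynomial of degree at most two in the momenta. -/
lemma blowup_conditions [CharZero K] {F : MvPolynomial (Fin 4) K}
    (hF : F.totalDegree ≤ 6) (hn : MomentumDegreeLE F 2) {a b α : K} (h : BlowupRegular F a b α) :
    eval ![a, b] (momentum F 2 0) = 0 ∧ eval ![a, b] (momentum F 1 1) = 0 ∧
    eval ![a, b] (momentum F 0 2) = 0 ∧
    eval ![a, b] (pderiv 1 (momentum F 1 1)) = eval ![a, b] (pderiv 0 (momentum F 2 0)) ∧
    eval ![a, b] (pderiv 0 (momentum F 1 1)) = eval ![a, b] (pderiv 1 (momentum F 0 2)) ∧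
    eval ![a, b] (momentum F 1 0) = -(α * eval ![a, b] (pderiv 0 (momentum F 2 0))) ∧
    eval ![a, b] (momentum F 0 1) = -(α * eval ![a, b] (pderiv 1 (momentum F 0 2))) := by
  have key (x z w : K) {i : ℕ} (hi : i < 2) :=
    (coeff_blowupPullback F a b α x z w 2 i).symm.trans
      (coeff_blowupPullback_eq_zero hF hn h x z w hi)
  have E₀ := fun w => key 0 0 w (i := 0) (by omega)
  have E₁ := fun z w => key 0 z w (i := 1) (by omega)
  simp [Finset.sum_range_succ, coeff_zero_restrict, coeff_one_restrict] at E₀ E₁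
  -- `E₀` is quadratic in w, and `E₁` is affine in z and cubic in w. The combinations below are
  -- finite differences extracting single coefficients.
  refine ⟨?_, ?_, ?_, ?_, ?_, ?_, ?_⟩
  · linear_combination E₀ 0
  · linear_combination (E₀ 1 - E₀ (-1)) / 2
  · linear_combination (E₀ 1 + E₀ (-1)) / 2 - E₀ 0
  · linear_combination (E₁ 1 1 - E₁ 0 1 - E₁ 1 (-1) + E₁ 0 (-1)) / 2 -
      (E₁ 1 2 - E₁ 0 2 - 3 * (E₁ 1 1 - E₁ 0 1) + 3 * (E₁ 1 0 - E₁ 0 0) - E₁ 1 (-1) + E₁ 0 (-1)) / 6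
  · linear_combination -(E₁ 1 1 - E₁ 0 1 + E₁ 1 (-1) - E₁ 0 (-1)) / 2 + (E₁ 1 0 - E₁ 0 0)
  · linear_combination E₁ 0 0
  · linear_combination (E₁ 0 1 - E₁ 0 (-1)) / 2 +
      α * ((E₁ 1 1 - E₁ 0 1 + E₁ 1 (-1) - E₁ 0 (-1)) / 2 - (E₁ 1 0 - E₁ 0 0))

/-- The shifts u p₁ + u' p₂ have momentum degree one, so they do not affect degree n + 1 ≥ 3, and
the conditions at all four centres bear on the same coefficient. Total degree 6 makes that
coefficient at most cubic. -/
lemma MomentumDegreeLE.pred [CharZero K] {F : MvPolynomial (Fin 4) K} (hF : F.totalDegree ≤ 6)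
    {n : ℕ} (hn : MomentumDegreeLE F (n + 1)) (hn3 : 2 ≤ n) (hn6 : n < 6) {η t s : K} (hη₀ : η ≠ 0)
    (hη₁ : η ≠ 1) (hts : t ≠ s)
    (h : ∀ v ∈ ({![t, s], ![η, η], ![1, 1], ![0, 0]} : Set (Fin 2 → K)), ∃ α u u' : K,
      BlowupRegular (F - C u * X 1 - C u' * X 3) (v 0) (v 1) α) :
    MomentumDegreeLE F n := by
  intro j l hjl
  rcases Nat.lt_or_ge (n + 1) (j + l) with hlt | hge
  · exact hn j l hlt
  have hsub (u u' : K) (j l : ℕ) (hjl : n < j + l) :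
      momentum (F - C u * X 1 - C u' * X 3) j l = momentum F j l := by
    rw [momentum_sub, momentum_sub, momentum_C_mul_X_one, momentum_C_mul_X_three,
      if_neg (by omega), if_neg (by omega), sub_zero, sub_zero]
  refine cubic_eq_zero ((totalDegree_momentum_le hF j l).trans (by omega)) hη₀ hη₁ hts
    fun v hv => ?_
  obtain ⟨α, u, u', hreg⟩ := h v hv
  have := eval_momentum_eq_zero (totalDegree_sub_le hF u u')
    (fun j l hjl => (hsub u u' j l (by omega)).trans (hn j l hjl)) (by omega) (by omega) hreg j l
    (by omega)
  rw [hsub u u' j l hjl] at this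
  rwa [show v = ![v 0, v 1] from List.ofFn_inj.mp rfl]

/-- A polynomial of degree at most six which is regular in the blow-up charts is at most quadratic
in the momenta. -/
lemma momentumDegreeLE_two [CharZero K] {F : MvPolynomial (Fin 4) K} (hF : F.totalDegree ≤ 6)
    {η t s : K} (hη₀ : η ≠ 0) (hη₁ : η ≠ 1) (hts : t ≠ s)
    (h : ∀ v ∈ ({![t, s], ![η, η], ![1, 1], ![0, 0]} : Set (Fin 2 → K)), ∃ α u u' : K,
      BlowupRegular (F - C u * X 1 - C u' * X 3) (v 0) (v 1) α) :
    MomentumDegreeLE F 2 := by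
  have h6 : MomentumDegreeLE F 6 := by
    intro j l hjl
    simp [momentum, fun i k => coef_eq_zero hF (show 6 < i + j + k + l by omega)]
  have h5 := h6.pred hF (by norm_num) (by norm_num) hη₀ hη₁ hts h
  have h4 := h5.pred hF (by norm_num) (by norm_num) hη₀ hη₁ hts h
  have h3 := h4.pred hF (by norm_num) (by norm_num) hη₀ hη₁ hts h
  exact h3.pred hF (by norm_num) (by norm_num) hη₀ hη₁ hts h

end Blowup

/-! ### Hamiltonians which are quadratic in the momenta -/

section Quadratic

variable {K : Type*} [Field K]

/-- The coefficients of a Hamiltonian which is quadratic in the momenta. -/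
structure Params (K : Type*) where
  /-- The coefficient of `q₁ ^ i * p₁ ^ 2`. -/
  a : Fin 5 → K
  /-- The coefficient of `q₁ ^ i * q₂ ^ k * p₁ * p₂`. -/
  b : Fin 3 → Fin 3 → K
  /-- The coefficient of `q₂ ^ k * p₂ ^ 2`. -/
  c : Fin 5 → K
  /-- The coefficient of `q₁ ^ i * p₁`. -/
  f : Fin 3 → K
  /-- The coefficient of `q₂ ^ k * p₂`. -/
  g : Fin 3 → K
  /-- The constant coefficient. -/
  e : K

/-- Exchange of the two degrees of freedom. -/
def Params.swap (P : Params K) : Params K := ⟨P.c, fun i k => P.b k i, P.a, P.g, P.f, P.e⟩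

/-- The Hamiltonian with given coefficients. -/
def quadHam (α₂ α₅ : K) (P : Params K) {R : Type*} [CommRing R] [Algebra K R] (q₁ p₁ q₂ p₂ : R) :
    R :=
  let C := algebraMap K R
  (C (P.a 0) + C (P.a 1) * q₁ + C (P.a 2) * q₁ ^ 2 + C (P.a 3) * q₁ ^ 3 + C (P.a 4) * q₁ ^ 4)
      * p₁ ^ 2
  + ((C (P.b 0 0) + C (P.b 0 1) * q₂ + C (P.b 0 2) * q₂ ^ 2)
    + (C (P.b 1 0) + C (P.b 1 1) * q₂ + C (P.b 1 2) * q₂ ^ 2) * q₁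
    + (C (P.b 2 0) + C (P.b 2 1) * q₂ + C (P.b 2 2) * q₂ ^ 2) * q₁ ^ 2) * (p₁ * p₂)
  + (C (P.c 0) + C (P.c 1) * q₂ + C (P.c 2) * q₂ ^ 2 + C (P.c 3) * q₂ ^ 3 + C (P.c 4) * q₂ ^ 4)
      * p₂ ^ 2
  + (C (P.f 0) + C (P.f 1) * q₁ + C (P.f 2) * q₁ ^ 2 + C (2 * α₂ * P.a 4) * q₁ ^ 3
    + C α₅ * q₂ * (C (P.b 0 2) + C (P.b 1 2) * q₁ + C (P.b 2 2) * q₁ ^ 2)) * p₁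
  + (C (P.g 0) + C (P.g 1) * q₂ + C (P.g 2) * q₂ ^ 2 + C (2 * α₅ * P.c 4) * q₂ ^ 3
    + C α₂ * q₁ * (C (P.b 2 0) + C (P.b 2 1) * q₂ + C (P.b 2 2) * q₂ ^ 2)) * p₂
  + (C P.e + C (α₂ * P.f 2 - α₂ ^ 2 * P.a 3) * q₁ + C (α₂ ^ 2 * P.a 4) * q₁ ^ 2
    + C (α₅ * P.g 2 - α₅ ^ 2 * P.c 3) * q₂ + C (α₅ ^ 2 * P.c 4) * q₂ ^ 2
    + C (α₂ * α₅ * P.b 2 2) * q₁ * q₂)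

lemma quadHam_swap (α₂ α₅ : K) (P : Params K) {R : Type*} [CommRing R] [Algebra K R]
    (q₁ p₁ q₂ p₂ : R) : quadHam α₂ α₅ P.swap q₁ p₁ q₂ p₂ = quadHam α₅ α₂ P q₂ p₂ q₁ p₁ := by
  simp only [quadHam, Params.swap, map_mul]
  ring

/-- The conditions on the coefficients which the blow-up with parameter `α` of `(x, y)` imposes;
`u` and `v` are the velocities of `x` and `y`. -/
def PointEq (α₂ α₅ : K) (P : Params K) (x y α u v : K) : Prop :=
  P.a 0 + P.a 1 * x + P.a 2 * x ^ 2 + P.a 3 * x ^ 3 + P.a 4 * x ^ 4 = 0 ∧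
  P.c 0 + P.c 1 * y + P.c 2 * y ^ 2 + P.c 3 * y ^ 3 + P.c 4 * y ^ 4 = 0 ∧
  (P.b 0 0 + P.b 0 1 * y + P.b 0 2 * y ^ 2) + (P.b 1 0 + P.b 1 1 * y + P.b 1 2 * y ^ 2) * x
    + (P.b 2 0 + P.b 2 1 * y + P.b 2 2 * y ^ 2) * x ^ 2 = 0 ∧
  (P.b 0 1 + 2 * P.b 0 2 * y) + (P.b 1 1 + 2 * P.b 1 2 * y) * x
    + (P.b 2 1 + 2 * P.b 2 2 * y) * x ^ 2
    = P.a 1 + 2 * P.a 2 * x + 3 * P.a 3 * x ^ 2 + 4 * P.a 4 * x ^ 3 ∧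
  (P.b 1 0 + P.b 1 1 * y + P.b 1 2 * y ^ 2) + 2 * (P.b 2 0 + P.b 2 1 * y + P.b 2 2 * y ^ 2) * x
    = P.c 1 + 2 * P.c 2 * y + 3 * P.c 3 * y ^ 2 + 4 * P.c 4 * y ^ 3 ∧
  P.f 0 + P.f 1 * x + P.f 2 * x ^ 2 + 2 * α₂ * P.a 4 * x ^ 3
    + α₅ * y * (P.b 0 2 + P.b 1 2 * x + P.b 2 2 * x ^ 2)
    = u - α * (P.a 1 + 2 * P.a 2 * x + 3 * P.a 3 * x ^ 2 + 4 * P.a 4 * x ^ 3) ∧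
  P.g 0 + P.g 1 * y + P.g 2 * y ^ 2 + 2 * α₅ * P.c 4 * y ^ 3
    + α₂ * x * (P.b 2 0 + P.b 2 1 * y + P.b 2 2 * y ^ 2)
    = v - α * (P.c 1 + 2 * P.c 2 * y + 3 * P.c 3 * y ^ 2 + 4 * P.c 4 * y ^ 3)

lemma PointEq.swap {α₂ α₅ : K} {P : Params K} {x y α u v : K} (h : PointEq α₂ α₅ P x y α u v) :
    PointEq α₅ α₂ P.swap y x α v u := by
  obtain ⟨h₁, h₂, h₃, h₄, h₅, h₆, h₇⟩ := h
  refine ⟨h₂, h₁, ?_, ?_, ?_, h₇, h₆⟩ <;> simp only [Params.swap]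
  · linear_combination h₃
  · linear_combination h₅
  · linear_combination h₄

/-- `P - κ P₁ - κ' P₂`, up to the constant coefficient. -/
def Params.comb (P P₁ P₂ : Params K) (κ κ' : K) : Params K :=
  ⟨fun i => P.a i - κ * P₁.a i - κ' * P₂.a i, fun i k => P.b i k - κ * P₁.b i k - κ' * P₂.b i k,
    fun i => P.c i - κ * P₁.c i - κ' * P₂.c i, fun i => P.f i - κ * P₁.f i - κ' * P₂.f i,
    fun i => P.g i - κ * P₁.g i - κ' * P₂.g i, P.e - κ * P₁.e - κ' * P₂.e⟩

lemma PointEq.comb {α₂ α₅ : K} {P P₁ P₂ : Params K} {x y α u v u₁ v₁ u₂ v₂ : K}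
    (h : PointEq α₂ α₅ P x y α u v) (h₁ : PointEq α₂ α₅ P₁ x y α u₁ v₁)
    (h₂ : PointEq α₂ α₅ P₂ x y α u₂ v₂) (κ κ' : K) :
    PointEq α₂ α₅ (P.comb P₁ P₂ κ κ') x y α (u - κ * u₁ - κ' * u₂) (v - κ * v₁ - κ' * v₂) := by
  obtain ⟨h₁₁, h₁₂, h₁₃, h₁₄, h₁₅, h₁₆, h₁₇⟩ := h₁
  obtain ⟨h₂₁, h₂₂, h₂₃, h₂₄, h₂₅, h₂₆, h₂₇⟩ := h₂
  obtain ⟨h₁, h₂, h₃, h₄, h₅, h₆, h₇⟩ := h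
  refine ⟨?_, ?_, ?_, ?_, ?_, ?_, ?_⟩ <;> simp only [Params.comb]
  · linear_combination h₁ - κ * h₁₁ - κ' * h₂₁
  · linear_combination h₂ - κ * h₁₂ - κ' * h₂₂
  · linear_combination h₃ - κ * h₁₃ - κ' * h₂₃
  · linear_combination h₄ - κ * h₁₄ - κ' * h₂₄
  · linear_combination h₅ - κ * h₁₅ - κ' * h₂₅
  · linear_combination h₆ - κ * h₁₆ - κ' * h₂₆
  · linear_combination h₇ - κ * h₁₇ - κ' * h₂₇

lemma quadHam_comb (α₂ α₅ : K) (P P₁ P₂ : Params K) (κ κ' : K) {R : Type*} [CommRing R]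
    [Algebra K R] (q₁ p₁ q₂ p₂ : R) : quadHam α₂ α₅ (P.comb P₁ P₂ κ κ') q₁ p₁ q₂ p₂ =
      quadHam α₂ α₅ P q₁ p₁ q₂ p₂ - algebraMap K R κ * quadHam α₂ α₅ P₁ q₁ p₁ q₂ p₂
        - algebraMap K R κ' * quadHam α₂ α₅ P₂ q₁ p₁ q₂ p₂ := by
  simp only [quadHam, Params.comb, map_mul, map_sub]
  ring

/-! ### Uniqueness of the solution at the four centres -/

lemma cubic_coeff_eq_zero {a₀ a₁ a₂ a₃ η t : K} (hη₀ : η ≠ 0) (hη₁ : η ≠ 1) (ht₀ : t ≠ 0)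
    (ht₁ : t ≠ 1) (htη : t ≠ η) (h₀ : a₀ = 0) (h₁ : a₀ + a₁ + a₂ + a₃ = 0)
    (hη : a₀ + a₁ * η + a₂ * η ^ 2 + a₃ * η ^ 3 = 0)
    (ht : a₀ + a₁ * t + a₂ * t ^ 2 + a₃ * t ^ 3 = 0) :
    a₁ = 0 ∧ a₂ = 0 ∧ a₃ = 0 := by
  have hη₁' := sub_ne_zero.mpr hη₁
  have ht₁' := sub_ne_zero.mpr ht₁
  have htη' := sub_ne_zero.mpr htη
  have e₁ : a₂ + a₃ * (η + 1) = 0 := by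
    refine (mul_eq_zero.mp (?_ : η * (η - 1) * _ = 0)).resolve_left (by simp [hη₀, hη₁'])
    linear_combination hη - η * h₁ + (η - 1) * h₀
  have e₂ : a₂ + a₃ * (t + 1) = 0 := by
    refine (mul_eq_zero.mp (?_ : t * (t - 1) * _ = 0)).resolve_left (by simp [ht₀, ht₁'])
    linear_combination ht - t * h₁ + (t - 1) * h₀
  have e₃ : a₃ = 0 := by
    refine (mul_eq_zero.mp (?_ : (t - η) * _ = 0)).resolve_left htη'
    linear_combination e₂ - e₁
  have e₄ : a₂ = 0 := by linear_combination e₁ - (η + 1) * e₃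
  exact ⟨by linear_combination h₁ - e₃ - e₄ - h₀, e₄, e₃⟩

/-- A biquadratic polynomial which is singular at three points of the diagonal and at one point
outside of it is zero. -/
lemma biquadratic_eq_zero {b : Fin 3 → Fin 3 → K} {η t s : K} (hη₀ : η ≠ 0) (hη₁ : η ≠ 1) (hts : t ≠ s)
    (h : ∀ v ∈ ({(t, s), (η, η), (1, 1), (0, 0)} : Set (K × K)),
      (b 0 0 + b 0 1 * v.2 + b 0 2 * v.2 ^ 2) + (b 1 0 + b 1 1 * v.2 + b 1 2 * v.2 ^ 2) * v.1
        + (b 2 0 + b 2 1 * v.2 + b 2 2 * v.2 ^ 2) * v.1 ^ 2 = 0 ∧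
      (b 0 1 + 2 * b 0 2 * v.2) + (b 1 1 + 2 * b 1 2 * v.2) * v.1
        + (b 2 1 + 2 * b 2 2 * v.2) * v.1 ^ 2 = 0 ∧
      (b 1 0 + b 1 1 * v.2 + b 1 2 * v.2 ^ 2)
        + 2 * (b 2 0 + b 2 1 * v.2 + b 2 2 * v.2 ^ 2) * v.1 = 0) :
    ∀ i k, b i k = 0 := by
  obtain ⟨z₀, z₁, z₂⟩ := h (0, 0) (by simp)
  obtain ⟨o₀, o₁, o₂⟩ := h (1, 1) (by simp)
  obtain ⟨e₀, e₁, e₂⟩ := h (η, η) (by simp)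
  obtain ⟨t₀, t₁, t₂⟩ := h (t, s) (by simp)
  simp only at z₀ z₁ z₂ o₀ o₁ o₂ e₀ e₁ e₂ t₀ t₁ t₂
  have hη : η - 1 ≠ 0 := sub_ne_zero.mpr hη₁
  have hd : t - s ≠ 0 := sub_ne_zero.mpr hts
  have b00 : b 0 0 = 0 := by linear_combination z₀
  have b01 : b 0 1 = 0 := by linear_combination z₁
  have b10 : b 1 0 = 0 := by linear_combination z₂
  simp only [b00, b01, b10] at o₀ o₁ o₂ e₀ e₁ e₂ t₀ t₁ t₂
  -- The restriction to the diagonal is a quartic with leading coefficient b₂₂ and double zeros at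
  -- 0, 1 and η.
  have b22 : b 2 2 = 0 := by
    refine (mul_eq_zero.mp (?_ : η ^ 2 * (η - 1) ^ 2 * _ = 0)).resolve_left (by simp [hη₀, hη])
    linear_combination e₀ - η ^ 2 * o₀ - η ^ 2 * (η - 1) * (o₁ + o₂ - 2 * o₀)
  simp only [b22] at o₀ o₁ o₂ e₀ e₁ e₂ t₀ t₁ t₂
  have h₃ : b 1 2 + b 2 1 = 0 := by linear_combination o₁ + o₂ - 2 * o₀
  have h₄ : 2 * b 1 2 + b 2 1 = 0 := by
    refine (mul_eq_zero.mp (?_ : η * (η - 1) * _ = 0)).resolve_left (by simp [hη₀, hη])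
    linear_combination e₁ - η * o₁
  have b12 : b 1 2 = 0 := by linear_combination h₄ - h₃
  have b21 : b 2 1 = 0 := by linear_combination h₃ - b12
  simp only [b12, b21] at o₀ o₁ o₂ t₀
  have b11 : b 1 1 = -2 * b 0 2 := by linear_combination o₁
  have b20 : b 2 0 = b 0 2 := by linear_combination o₀ - b11
  -- What remains is b₀₂ (x - y)², which must vanish at (t, s).
  have b02 : b 0 2 = 0 := by
    refine (mul_eq_zero.mp (?_ : (t - s) ^ 2 * _ = 0)).resolve_left (pow_ne_zero 2 hd)
    linear_combination t₀ - t * s * b11 - t ^ 2 * b20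
  rw [b02] at b11 b20
  intro i k
  fin_cases i <;> fin_cases k <;> simp [b00, b01, b02, b10, b11, b12, b20, b21, b22]

/-- Without their quartic terms, a and c are cubics with four roots. Then the biquadratic b is
singular at all four centres, hence zero. Then f and g are quadratics vanishing at 0, 1 and η, and
the equations at (t, s) reduce to u = v = 0. -/
lemma params_eq_zero {P : Params K} {α₂ α₅ α₀ α₁ α₃ α₄ η t s u v : K}
    (hη₀ : η ≠ 0) (hη₁ : η ≠ 1) (ht₀ : t ≠ 0) (ht₁ : t ≠ 1) (htη : t ≠ η) (hs₀ : s ≠ 0)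
    (hs₁ : s ≠ 1) (hsη : s ≠ η) (hts : t ≠ s) (ha : P.a 4 = 0) (hc : P.c 4 = 0)
    (hP₀ : PointEq α₂ α₅ P t s α₀ u v) (hP₁ : PointEq α₂ α₅ P η η α₁ 0 0)
    (hP₃ : PointEq α₂ α₅ P 1 1 α₃ 0 0) (hP₄ : PointEq α₂ α₅ P 0 0 α₄ 0 0) :
    P = ⟨0, 0, 0, 0, 0, P.e⟩ ∧ u = 0 ∧ v = 0 := by
  obtain ⟨t₁, t₂, t₃, t₄, t₅, t₆, t₇⟩ := hP₀
  obtain ⟨e₁, e₂, e₃, e₄, e₅, e₆, e₇⟩ := hP₁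
  obtain ⟨o₁, o₂, o₃, o₄, o₅, o₆, o₇⟩ := hP₃
  obtain ⟨z₁, z₂, z₃, z₄, z₅, z₆, z₇⟩ := hP₄
  have a0 : P.a 0 = 0 := by linear_combination z₁
  have c0 : P.c 0 = 0 := by linear_combination z₂
  obtain ⟨a1, a2, a3⟩ := cubic_coeff_eq_zero (a₁ := P.a 1) (a₂ := P.a 2) (a₃ := P.a 3)
    hη₀ hη₁ ht₀ ht₁ htη a0
    (by linear_combination o₁ - ha) (by linear_combination e₁ - η ^ 4 * ha)
    (by linear_combination t₁ - t ^ 4 * ha)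
  obtain ⟨c1, c2, c3⟩ := cubic_coeff_eq_zero (a₁ := P.c 1) (a₂ := P.c 2) (a₃ := P.c 3)
    hη₀ hη₁ hs₀ hs₁ hsη c0
    (by linear_combination o₂ - hc) (by linear_combination e₂ - η ^ 4 * hc)
    (by linear_combination t₂ - s ^ 4 * hc)
  simp only [a1, a2, a3, ha, c1, c2, c3, hc, mul_zero, zero_mul, add_zero, sub_zero]
    at t₃ t₄ t₅ t₆ t₇ e₃ e₄ e₅ e₆ e₇ o₃ o₄ o₅ o₆ o₇ z₃ z₄ z₅ z₆ z₇
  have hb := biquadratic_eq_zero (b := P.b) hη₀ hη₁ hts (by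
    rintro ⟨x, y⟩ h
    simp only [Set.mem_insert_iff, Set.mem_singleton_iff, Prod.mk.injEq] at h
    rcases h with ⟨rfl, rfl⟩ | ⟨rfl, rfl⟩ | ⟨rfl, rfl⟩ | ⟨rfl, rfl⟩
    · exact ⟨t₃, t₄, t₅⟩
    · exact ⟨e₃, e₄, e₅⟩
    · exact ⟨o₃, o₄, o₅⟩
    · simp only [mul_zero, add_zero]
      exact ⟨z₃, z₄, z₅⟩)
  simp only [hb, mul_zero, zero_mul, add_zero] at t₆ t₇ e₆ e₇ o₆ o₇ z₆ z₇
  have hη₁' := sub_ne_zero.mpr hη₁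
  have f0 : P.f 0 = 0 := by linear_combination z₆
  have g0 : P.g 0 = 0 := by linear_combination z₇
  have f2 : P.f 2 = 0 := by
    refine (mul_eq_zero.mp (?_ : η * (η - 1) * _ = 0)).resolve_left (by simp [hη₀, hη₁'])
    linear_combination e₆ - η * o₆ + (η - 1) * f0
  have g2 : P.g 2 = 0 := by
    refine (mul_eq_zero.mp (?_ : η * (η - 1) * _ = 0)).resolve_left (by simp [hη₀, hη₁'])
    linear_combination e₇ - η * o₇ + (η - 1) * g0
  have f1 : P.f 1 = 0 := by linear_combination o₆ - f0 - f2
  have g1 : P.g 1 = 0 := by linear_combination o₇ - g0 - g2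
  refine ⟨?_, ?_, ?_⟩
  · cases P
    simp only [Params.mk.injEq, and_true]
    refine ⟨?_, ?_, ?_, ?_, ?_⟩
    · ext i
      fin_cases i <;> assumption
    · ext i k
      exact hb i k
    · ext i
      fin_cases i <;> assumption
    · ext i
      fin_cases i <;> assumption
    · ext i
      fin_cases i <;> assumption
  · linear_combination -t₆ + f0 + t * f1 + t ^ 2 * f2
  · linear_combination -t₇ + g0 + s * g1 + s ^ 2 * g2

/-- The coefficients of the first Hamiltonian. -/
def garnierParams (η t s α₁ α₂ α₃ α₄ α₅ : K) : Params K :=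
  let i₁ := 1 / (t * (t - 1) * (t - s))
  let i₂ := 1 / (t * (t - 1) * (t - η))
  { a := ![0, -(i₂ * (η * t)), i₂ * (η + t + η * t), -(i₂ * (1 + η + t)), i₂]
    b := ![![0, i₁ * (t - s) * t - i₂ * t ^ 2, i₂ * t ^ 2 - i₁ * (t - 1) * t],
      ![0, 2 * i₁ * t * (s - 1) + 2 * i₂ * t, -(2 * i₂ * t)],
      ![-(i₁ * (t - 1) * s), i₁ * (t - s) - i₂, i₂]]
    c := 0
    f := ![i₂ * α₄ * t * η,
      i₂ * (-(α₁ * (t - η)) + 2 * α₂ * η - α₃ * (t - 1) * η - α₄ * t * (1 + η))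
        + α₅ * (i₁ * (t * (t - 1) - (t - s)) - i₂ * t * (t - 1)),
      i₂ * (α₁ * (t - η) - 2 * α₂ * (1 + η) + α₃ * (t - 1) + α₄ * t)
        + α₅ * (i₁ * (t - s) + i₂ * (t - 1))]
    g := ![0, α₂ * (i₁ * t * (s - 1) + i₂ * t), -(α₂ * i₂ * t)]
    e := 0 }

/-- The source of the parameter relation: the equations at the moving centre hold for every α₀, but
the velocity they force is the sum of the parameters instead of 1. -/
lemma pointEq_garnierParams_moving {η t s : K} (ht₀ : t ≠ 0) (ht₁ : t ≠ 1) (htη : t ≠ η)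
    (hts : t ≠ s) (α₀ α₁ α₂ α₃ α₄ α₅ : K) :
    PointEq α₂ α₅ (garnierParams η t s α₁ α₂ α₃ α₄ α₅) t s α₀
      (α₀ + α₁ + 2 * α₂ + α₃ + α₄ + 2 * α₅) 0 := by
  have ht₁' := sub_ne_zero.mpr ht₁
  have htη' := sub_ne_zero.mpr htη
  have hts' := sub_ne_zero.mpr hts
  refine ⟨?_, ?_, ?_, ?_, ?_, ?_, ?_⟩ <;> simp [garnierParams] <;> field_simp <;> ring

lemma pointEq_garnierParams_diag {η t s : K} (ht₀ : t ≠ 0) (ht₁ : t ≠ 1) (htη : t ≠ η)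
    (hts : t ≠ s) (α₁ α₂ α₃ α₄ α₅ : K) :
    PointEq α₂ α₅ (garnierParams η t s α₁ α₂ α₃ α₄ α₅) η η α₁ 0 0 ∧
    PointEq α₂ α₅ (garnierParams η t s α₁ α₂ α₃ α₄ α₅) 1 1 α₃ 0 0 ∧
    PointEq α₂ α₅ (garnierParams η t s α₁ α₂ α₃ α₄ α₅) 0 0 α₄ 0 0 := by
  have ht₁' := sub_ne_zero.mpr ht₁
  have htη' := sub_ne_zero.mpr htη
  have hts' := sub_ne_zero.mpr hts
  refine ⟨⟨?_, ?_, ?_, ?_, ?_, ?_, ?_⟩, ⟨?_, ?_, ?_, ?_, ?_, ?_, ?_⟩, ⟨?_, ?_, ?_, ?_, ?_, ?_, ?_⟩⟩ <;>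
    simp [garnierParams] <;> field_simp <;> ring

lemma hamExpr_eq_quadHam {η t s : TimeField} (ht₀ : t ≠ 0) (ht₁ : t ≠ 1) (htη : t ≠ η)
    (hts : t ≠ s) (α₁ α₂ α₃ α₄ α₅ : TimeField) (q₁ p₁ q₂ p₂ : PhaseRing) :
    hamExpr η q₁ p₁ q₂ p₂ t s α₁ α₂ α₃ α₄ α₅ =
      quadHam α₂ α₅ (garnierParams η t s α₁ α₂ α₃ α₄ α₅) q₁ p₁ q₂ p₂ := by
  have ht₁' := sub_ne_zero.mpr ht₁
  have htη' := sub_ne_zero.mpr htη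
  have hts' := sub_ne_zero.mpr hts
  -- Both sides are 1 / (t (t - 1)). This is the only relation needed between the two prefactors,
  -- and it serves the coefficient of α₂ α₅ q₁.
  have h : 1 / (t * (t - 1) * (t - s)) * (t - s) = 1 / (t * (t - 1) * (t - η)) * (t - η) := by
    field_simp
  have hα : (C (α₂ * α₅ / (t * (t - 1) * (t - η))) : PhaseRing) =
      C α₂ * C α₅ * C (1 / (t * (t - 1) * (t - η))) := by
    rw [← C_mul, ← C_mul]
    congr 1
    ring
  simp only [hamExpr, HVI, quadHam, garnierParams, hα]
  generalize 1 / (t * (t - 1) * (t - s)) = i₁ at *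
  generalize 1 / (t * (t - 1) * (t - η)) = i₂ at *
  have h' := congrArg (C : TimeField → PhaseRing) h
  have h₂ : (C 2 : PhaseRing) = 2 := map_ofNat C 2
  simp [MvPolynomial.algebraMap_eq, h₂] at h' ⊢
  linear_combination -(C α₂ * C α₅ * q₁) * h'

end Quadratic

/-! ### Regularity in the charts at infinity -/

section Infinity

variable {K : Type*} [Field K]

/-- `x ^ 6 * ∑ u i j * q ^ i * p ^ j` along `infinityCurve`, as a polynomial in `x`. -/
def infinityPullback (u : ℕ → ℕ → K) (α y : K) : Polynomial K :=
  ∑ i ∈ Finset.range 7, Polynomial.X ^ (6 - i) * ∑ j ∈ Finset.range 3, Polynomial.C (u i j) *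
    (-(Polynomial.X * (Polynomial.X * Polynomial.C y + Polynomial.C α))) ^ j

lemma aeval_infinityPullback (u : ℕ → ℕ → K) (α y : K) {A : Type*} [CommRing A] [Algebra K A]
    {Y Y' : A} (hY : Y * Y' = 1) :
    Polynomial.aeval Y (infinityPullback u α y) = Y ^ 6 * ∑ i ∈ Finset.range 7,
      ∑ j ∈ Finset.range 3, algebraMap K A (u i j) *
        (Y' ^ i * (-(Y * (Y * algebraMap K A y + algebraMap K A α))) ^ j) := by
  rw [infinityPullback, map_sum, Finset.mul_sum]
  refine Finset.sum_congr rfl fun i hi => ?_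
  obtain ⟨k, hk⟩ := Nat.exists_eq_add_of_le (Nat.lt_succ_iff.mp (Finset.mem_range.mp hi))
  have hpow : Y ^ i * Y' ^ i = 1 := by rw [← mul_pow, hY, one_pow]
  rw [map_mul, map_sum, Finset.mul_sum, Finset.mul_sum]
  refine Finset.sum_congr rfl fun j _ => ?_
  simp only [map_mul, map_pow, map_neg, map_add, Polynomial.aeval_X, Polynomial.aeval_C]
  rw [show 6 - i = k by omega, hk, pow_add]
  linear_combination -(Y ^ k * algebraMap K A (u i j) *
    (-(Y * (Y * algebraMap K A y + algebraMap K A α))) ^ j) * hpow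

/-- The relations between coefficients which a chart at infinity imposes. -/
lemma infinity_relations [CharZero K] {u : ℕ → ℕ → K} {α : K}
    (h : ∀ y, ∀ m < 6, (infinityPullback u α y).coeff m = 0) :
    u 5 2 = 0 ∧ u 6 2 = 0 ∧ u 3 1 - 2 * α * u 4 2 = 0 ∧ u 4 1 = 0 ∧ u 5 1 = 0 ∧ u 6 1 = 0 ∧
    u 1 0 - α * u 2 1 + α ^ 2 * u 3 2 = 0 ∧ u 2 0 - α ^ 2 * u 4 2 = 0 ∧
    u 3 0 = 0 ∧ u 4 0 = 0 ∧ u 5 0 = 0 ∧ u 6 0 = 0 := by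
  have hcoeff (y : K) (m : ℕ) : (infinityPullback u α y).coeff m =
      ∑ i ∈ Finset.range 7, if 6 - i ≤ m then
        (Polynomial.C (u i 0) - Polynomial.C (α * u i 1) * Polynomial.X
          + Polynomial.C (α ^ 2 * u i 2 - y * u i 1) * Polynomial.X ^ 2
          + Polynomial.C (2 * α * y * u i 2) * Polynomial.X ^ 3
          + Polynomial.C (y ^ 2 * u i 2) * Polynomial.X ^ 4).coeff (m - (6 - i)) else 0 := by
    rw [infinityPullback, Polynomial.finsetSum_coeff]
    refine Finset.sum_congr rfl fun i _ => ?_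
    rw [Polynomial.coeff_X_pow_mul']
    congr 2
    have h₂ : (Polynomial.C 2 : Polynomial K) = 2 := map_ofNat Polynomial.C 2
    simp [Finset.sum_range_succ, h₂]
    ring
  have k (y : K) (m : ℕ) (hm : m < 6) := (hcoeff y m).symm.trans (h y m hm)
  have k₁ := fun y => k y 5 (by norm_num)
  have k₂ := fun y => k y 4 (by norm_num)
  have k₃ := fun y => k y 3 (by norm_num)
  have k₄ := fun y => k y 2 (by norm_num)
  have k₅ := fun y => k y 1 (by norm_num)
  have k₆ := fun y => k y 0 (by norm_num)
  simp [Finset.sum_range_succ, Polynomial.coeff_X, Polynomial.coeff_C, Polynomial.coeff_X_pow,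
    -map_mul, -map_sub, -map_pow] at k₁ k₂ k₃ k₄ k₅ k₆
  -- Each relation is polynomial of degree at most two in y; its coefficients are extracted from y =
  -- 0, 1, -1.
  have r₁ : u 5 2 = 0 := by linear_combination (k₁ 1 + k₁ (-1)) / 2 - k₁ 0
  have r₂ : u 6 2 = 0 := by linear_combination (k₂ 1 + k₂ (-1)) / 2 - k₂ 0
  have r₃ : u 3 1 - 2 * α * u 4 2 = 0 := by linear_combination -(k₁ 1 - k₁ (-1)) / 2
  have r₄ : u 4 1 = 0 := by linear_combination -(k₂ 1 - k₂ (-1)) / 2 + 2 * α * r₁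
  have r₅ : u 5 1 = 0 := by linear_combination -(k₃ 1 - k₃ (-1)) / 2 + 2 * α * r₂
  have r₆ : u 6 1 = 0 := by linear_combination -(k₄ 1 - k₄ (-1)) / 2
  refine ⟨r₁, r₂, r₃, r₄, r₅, r₆, ?_, ?_, ?_, ?_, ?_, k₆⟩
  · linear_combination k₁ 0
  · linear_combination k₂ 0 + α * r₃
  · linear_combination k₃ 0 + α * r₄ - α ^ 2 * r₁
  · linear_combination k₄ 0 + α * r₅ - α ^ 2 * r₂
  · linear_combination k₅ + α * r₆

lemma eq_zero_of_forall_sum_sum [CharZero K] {v : ℕ → ℕ → K} {n : ℕ}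
    (h : ∀ z w : K, ∑ k ∈ Finset.range n, ∑ l ∈ Finset.range n, v k l * (z ^ k * w ^ l) = 0)
    {k l : ℕ} (hk : k < n) (hl : l < n) : v k l = 0 := by
  refine eq_zero_of_forall_sum_pow (u := fun l => v k l) (fun w => ?_) hl
  refine eq_zero_of_forall_sum_pow (u := fun k => ∑ l ∈ Finset.range n, w ^ l * v k l)
    (fun z => ?_) hk
  rw [← h z w]
  refine Finset.sum_congr rfl fun k _ => ?_
  rw [Finset.mul_sum]
  exact Finset.sum_congr rfl fun l _ => by ring

lemma infinity_relations_coef [CharZero K] {g : ℕ → ℕ → ℕ → ℕ → K} {α : K}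
    (h : ∀ y z w, ∀ m < 6, (infinityPullback (fun i j => ∑ k ∈ Finset.range 7,
      ∑ l ∈ Finset.range 7, g i j k l * (z ^ k * w ^ l)) α y).coeff m = 0)
    {k l : ℕ} (hk : k < 7) (hl : l < 7) :
    g 5 2 k l = 0 ∧ g 6 2 k l = 0 ∧ g 3 1 k l = 2 * α * g 4 2 k l ∧ g 4 1 k l = 0 ∧
    g 5 1 k l = 0 ∧ g 6 1 k l = 0 ∧ g 1 0 k l = α * g 2 1 k l - α ^ 2 * g 3 2 k l ∧
    g 2 0 k l = α ^ 2 * g 4 2 k l ∧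
    g 3 0 k l = 0 ∧ g 4 0 k l = 0 ∧ g 5 0 k l = 0 ∧ g 6 0 k l = 0 := by
  have key := fun z w => infinity_relations (fun y => h y z w)
  refine ⟨?_, ?_, ?_, ?_, ?_, ?_, ?_, ?_, ?_, ?_, ?_, ?_⟩
  · exact eq_zero_of_forall_sum_sum (fun z w => (key z w).1) hk hl
  · exact eq_zero_of_forall_sum_sum (fun z w => (key z w).2.1) hk hl
  · refine sub_eq_zero.mp (eq_zero_of_forall_sum_sum
      (v := fun k l => g 3 1 k l - 2 * α * g 4 2 k l) (fun z w => ?_) hk hl)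
    rw [← (key z w).2.2.1]
    simp only [sub_mul, Finset.sum_sub_distrib, Finset.mul_sum, mul_assoc]
  · exact eq_zero_of_forall_sum_sum (fun z w => (key z w).2.2.2.1) hk hl
  · exact eq_zero_of_forall_sum_sum (fun z w => (key z w).2.2.2.2.1) hk hl
  · exact eq_zero_of_forall_sum_sum (fun z w => (key z w).2.2.2.2.2.1) hk hl
  · refine sub_eq_zero.mp (eq_zero_of_forall_sum_sum
      (v := fun k l => g 1 0 k l - (α * g 2 1 k l - α ^ 2 * g 3 2 k l)) (fun z w => ?_) hk hl)
    rw [← (key z w).2.2.2.2.2.2.1]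
    simp only [sub_mul, add_mul, ← sub_add, Finset.sum_sub_distrib, Finset.sum_add_distrib,
      Finset.mul_sum, mul_assoc]
  · refine sub_eq_zero.mp (eq_zero_of_forall_sum_sum
      (v := fun k l => g 2 0 k l - α ^ 2 * g 4 2 k l) (fun z w => ?_) hk hl)
    rw [← (key z w).2.2.2.2.2.2.2.1]
    simp only [sub_mul, Finset.sum_sub_distrib, Finset.mul_sum, mul_assoc]
  · exact eq_zero_of_forall_sum_sum (fun z w => (key z w).2.2.2.2.2.2.2.2.1) hk hl
  · exact eq_zero_of_forall_sum_sum (fun z w => (key z w).2.2.2.2.2.2.2.2.2.1) hk hl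
  · exact eq_zero_of_forall_sum_sum (fun z w => (key z w).2.2.2.2.2.2.2.2.2.2.1) hk hl
  · exact eq_zero_of_forall_sum_sum (fun z w => (key z w).2.2.2.2.2.2.2.2.2.2.2) hk hl

/-! ### From regularity at infinity to the shape of the Hamiltonian -/

lemma MomentumDegreeLE.coef_eq_zero {F : MvPolynomial (Fin 4) K} (hF : F.totalDegree ≤ 6) {n : ℕ}
    (hn : MomentumDegreeLE F n) (i j k l : ℕ) (h : n < j + l) : coef F i j k l = 0 :=
  coef_eq_zero_of_momentum hF (hn j l h) i k

lemma aeval_eq_sum_first {F : MvPolynomial (Fin 4) K} (hF : F.totalDegree ≤ 6)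
    (hn : MomentumDegreeLE F 2) {A : Type*} [CommRing A] [Algebra K A] (z w : K) (Q P : A) :
    aeval ![Q, P, algebraMap K A z, algebraMap K A w] F =
      ∑ i ∈ Finset.range 7, ∑ j ∈ Finset.range 3, algebraMap K A (∑ k ∈ Finset.range 7,
        ∑ l ∈ Finset.range 7, coef F i j k l * (z ^ k * w ^ l)) * (Q ^ i * P ^ j) := by
  rw [aeval_eq_sum_coef hF, Finset.sum_comm (s := Finset.range 7) (t := Finset.range 3),
    ← Finset.sum_subset (s₁ := Finset.range 3)
      (Finset.range_subset_range.mpr (by norm_num : 3 ≤ 6 + 1))]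
  · refine Finset.sum_congr rfl fun j _ => ?_
    rw [Finset.sum_comm]
    refine Finset.sum_congr rfl fun i _ => ?_
    rw [Finset.sum_comm, map_sum, Finset.sum_mul]
    refine Finset.sum_congr rfl fun k _ => ?_
    rw [map_sum, Finset.sum_mul]
    refine Finset.sum_congr rfl fun l _ => ?_
    simp
    ring
  · intro j _ hj
    rw [Finset.mem_range, not_lt] at hj
    simp [fun i k l => hn.coef_eq_zero hF i j k l (by omega)]

lemma aeval_eq_sum_second {F : MvPolynomial (Fin 4) K} (hF : F.totalDegree ≤ 6)
    (hn : MomentumDegreeLE F 2) {A : Type*} [CommRing A] [Algebra K A] (z w : K) (Q P : A) :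
    aeval ![algebraMap K A z, algebraMap K A w, Q, P] F =
      ∑ i ∈ Finset.range 7, ∑ j ∈ Finset.range 3, algebraMap K A (∑ k ∈ Finset.range 7,
        ∑ l ∈ Finset.range 7, coef F k l i j * (z ^ k * w ^ l)) * (Q ^ i * P ^ j) := by
  rw [aeval_eq_sum_coef hF, Finset.sum_comm, Finset.sum_comm (s := Finset.range 7)
    (t := Finset.range 3), ← Finset.sum_subset (s₁ := Finset.range 3)
      (Finset.range_subset_range.mpr (by norm_num : 3 ≤ 6 + 1))]
  · refine Finset.sum_congr rfl fun l _ => ?_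
    simp only [map_sum, Finset.sum_mul]
    rw [Finset.sum_congr rfl fun j _ => Finset.sum_comm, Finset.sum_comm]
    refine Finset.sum_congr rfl fun k _ => ?_
    rw [Finset.sum_comm]
    refine Finset.sum_congr rfl fun i _ => Finset.sum_congr rfl fun j _ => ?_
    simp
    ring
  · intro l _ hl
    rw [Finset.mem_range, not_lt] at hl
    simp [fun i j k => hn.coef_eq_zero hF i j k l (by omega)]

/-- The derivative of `F` with respect to the coordinate `x = 1 / q₁` is polynomial. -/
def InfinityRegularFirst (F : MvPolynomial (Fin 4) K) (α : K) : Prop :=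
  ∀ y z w : K, ∃ P : Polynomial K, ∀ x ≠ 0,
    ∑ i, ![-(1 / x ^ 2), -(2 * x * y + α), 0, 0] i *
      eval ![1 / x, -(x * (x * y + α)), z, w] (pderiv i F) = P.eval x

/-- The derivative of `F` with respect to the coordinate `z = 1 / q₂` is polynomial. -/
def InfinityRegularSecond (F : MvPolynomial (Fin 4) K) (α : K) : Prop :=
  ∀ y z w : K, ∃ P : Polynomial K, ∀ x ≠ 0,
    ∑ i, ![0, 0, -(1 / x ^ 2), -(2 * x * y + α)] i *
      eval ![z, w, 1 / x, -(x * (x * y + α))] (pderiv i F) = P.eval x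

lemma dual_mul_inverse {x : K} (hx : x ≠ 0) :
    (TrivSqZeroExt.inl x + TrivSqZeroExt.inr 1 : DualNumber K) *
      (TrivSqZeroExt.inl (1 / x) + TrivSqZeroExt.inr (-(1 / x ^ 2))) = 1 := by
  ext
  · simp [hx]
  · simp
    field_simp
    ring

lemma dual_infinity (x y α : K) :
    -((TrivSqZeroExt.inl x + TrivSqZeroExt.inr 1) * ((TrivSqZeroExt.inl x + TrivSqZeroExt.inr 1) *
      algebraMap K (DualNumber K) y + algebraMap K (DualNumber K) α)) =
      TrivSqZeroExt.inl (-(x * (x * y + α))) + TrivSqZeroExt.inr (-(2 * x * y + α)) := by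
  ext
  · simp [TrivSqZeroExt.algebraMap_eq_inl]
  · simp [TrivSqZeroExt.algebraMap_eq_inl]
    ring

lemma InfinityRegularFirst.relations [CharZero K] {F : MvPolynomial (Fin 4) K}
    (hF : F.totalDegree ≤ 6) (hn : MomentumDegreeLE F 2) {α : K} (h : InfinityRegularFirst F α) :
    ∀ y z w, ∀ m < 6, (infinityPullback (fun i j => ∑ k ∈ Finset.range 7,
      ∑ l ∈ Finset.range 7, coef F i j k l * (z ^ k * w ^ l)) α y).coeff m = 0 := by
  intro y z w
  obtain ⟨P, hP⟩ := h y z w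
  -- Total degree 6 bounds the power of q₁ = 1/x, so x⁶ clears every pole.
  refine coeff_eq_zero_of_curve F 6 _ P _ _ (fun x hx => ?_) hP
  rw [aeval_infinityPullback _ _ _ (dual_mul_inverse hx), ← aeval_eq_sum_first hF hn,
    dual_infinity]
  congr 3
  funext i
  fin_cases i <;> simp [TrivSqZeroExt.algebraMap_eq_inl]

lemma InfinityRegularSecond.relations [CharZero K] {F : MvPolynomial (Fin 4) K}
    (hF : F.totalDegree ≤ 6) (hn : MomentumDegreeLE F 2) {α : K} (h : InfinityRegularSecond F α) :
    ∀ y z w, ∀ m < 6, (infinityPullback (fun i j => ∑ k ∈ Finset.range 7,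
      ∑ l ∈ Finset.range 7, coef F k l i j * (z ^ k * w ^ l)) α y).coeff m = 0 := by
  intro y z w
  obtain ⟨P, hP⟩ := h y z w
  refine coeff_eq_zero_of_curve F 6 _ P _ _ (fun x hx => ?_) hP
  rw [aeval_infinityPullback _ _ _ (dual_mul_inverse hx), ← aeval_eq_sum_second hF hn,
    dual_infinity]
  congr 3
  funext i
  fin_cases i <;> simp [TrivSqZeroExt.algebraMap_eq_inl]

/-- The coefficients of a Hamiltonian as a polynomial which is quadratic in the momenta. -/
def paramsOf (F : MvPolynomial (Fin 4) K) : Params K :=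
  ⟨fun i => coef F i 2 0 0, fun i k => coef F i 1 k 1, fun k => coef F 0 0 k 2,
    fun i => coef F i 1 0 0, fun k => coef F 0 0 k 1, coef F 0 0 0 0⟩

/-- Each chart relates coefficients carrying a fixed monomial in the other conjugate pair. Terms of
momentum degree above two drop out when the two families are combined. -/
lemma coef_relations [CharZero K] {F : MvPolynomial (Fin 4) K} (hF : F.totalDegree ≤ 6)
    (hn : MomentumDegreeLE F 2) {α₂ α₅ : K} (h₂ : InfinityRegularFirst F α₂)
    (h₅ : InfinityRegularSecond F α₅) {i k : ℕ} (hi : i < 7) (hk : k < 7) :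
    (k ≠ 0 ∨ 5 ≤ i → coef F i 2 k 0 = 0) ∧ (i ≠ 0 ∨ 5 ≤ k → coef F i 0 k 2 = 0) ∧
    (3 ≤ i ∨ 3 ≤ k → coef F i 1 k 1 = 0) ∧
    coef F i 1 1 0 = α₅ * coef F i 1 2 1 ∧ (2 ≤ k → coef F i 1 k 0 = 0) ∧
    coef F 3 1 0 0 = 2 * α₂ * coef F 4 2 0 0 ∧ (4 ≤ i → coef F i 1 0 0 = 0) ∧
    coef F 1 0 k 1 = α₂ * coef F 2 1 k 1 ∧ (2 ≤ i → coef F i 0 k 1 = 0) ∧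
    coef F 0 0 3 1 = 2 * α₅ * coef F 0 0 4 2 ∧ (4 ≤ k → coef F 0 0 k 1 = 0) ∧
    (1 ≤ k → coef F 1 0 k 0 = α₂ * coef F 2 1 k 0) ∧ (1 ≤ k → coef F 2 0 k 0 = 0) ∧
    (3 ≤ i → coef F i 0 k 0 = 0) ∧ (3 ≤ k → coef F 0 0 k 0 = 0) ∧
    coef F 1 0 0 0 = α₂ * coef F 2 1 0 0 - α₂ ^ 2 * coef F 3 2 0 0 ∧
    coef F 2 0 0 0 = α₂ ^ 2 * coef F 4 2 0 0 ∧
    coef F 0 0 1 0 = α₅ * coef F 0 0 2 1 - α₅ ^ 2 * coef F 0 0 3 2 ∧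
    coef F 0 0 2 0 = α₅ ^ 2 * coef F 0 0 4 2 := by
  have r {k l : ℕ} := infinity_relations_coef (g := coef F) (h₂.relations hF hn) (k := k) (l := l)
  have r' {k l : ℕ} := infinity_relations_coef (g := fun i j k l => coef F k l i j)
    (h₅.relations hF hn) (k := k) (l := l)
  have z₂₁ (i k : ℕ) : coef F i 2 k 1 = 0 := hn.coef_eq_zero hF i 2 k 1 (by norm_num)
  have z₁₂ (i k : ℕ) : coef F i 1 k 2 = 0 := hn.coef_eq_zero hF i 1 k 2 (by norm_num)
  have z₂₂ (i k : ℕ) : coef F i 2 k 2 = 0 := hn.coef_eq_zero hF i 2 k 2 (by norm_num)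
  have a {k : ℕ} (hk : k < 7) (l : ℕ) (hl : l < 3) := r hk (show l < 7 by omega)
  have b {i : ℕ} (hi : i < 7) (l : ℕ) (hl : l < 3) := r' hi (show l < 7 by omega)
  have a₀ := a hk 0 (by norm_num)
  have a₁ := a hk 1 (by norm_num)
  have a₂ := a hk 2 (by norm_num)
  have b₀ := b hi 0 (by norm_num)
  have b₁ := b hi 1 (by norm_num)
  have b₂ := b hi 2 (by norm_num)
  have a₀₀ := a (show 0 < 7 by norm_num) 0 (by norm_num)
  have b₀₀ := b (show 0 < 7 by norm_num) 0 (by norm_num)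
  have b₃₂ := b (show 3 < 7 by norm_num) 2 (by norm_num)
  have b₄₂ := b (show 4 < 7 by norm_num) 2 (by norm_num)
  clear r r' a b h₂ h₅ hn hF
  simp only [z₂₁, z₁₂, z₂₂, mul_zero, sub_zero] at a₀ a₁ a₂ b₀ b₁ b₂ a₀₀ b₀₀ b₃₂ b₄₂
  -- The second chart, applied to the coefficients of q₁³p₁² and q₁⁴p₁², shows them free of q₂. This
  -- removes the α₂² terms from the relations for k ≥ 1.
  have c₁ (h : 1 ≤ k) : coef F 3 2 k 0 = 0 ∧ coef F 4 2 k 0 = 0 := by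
    obtain rfl | rfl | rfl | rfl | rfl | rfl :
      k = 1 ∨ k = 2 ∨ k = 3 ∨ k = 4 ∨ k = 5 ∨ k = 6 := by omega
    all_goals simp [b₃₂, b₄₂]
  refine ⟨?_, ?_, ?_, b₁.2.2.2.2.2.2.1, ?_, a₀₀.2.2.1, ?_, a₁.2.2.2.2.2.2.1, ?_, b₀₀.2.2.1, ?_, ?_,
    ?_, ?_, ?_, a₀₀.2.2.2.2.2.2.1, a₀₀.2.2.2.2.2.2.2.1, b₀₀.2.2.2.2.2.2.1, b₀₀.2.2.2.2.2.2.2.1⟩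
  · rintro (h | h)
    · obtain rfl | rfl | rfl | rfl | rfl | rfl :
        k = 1 ∨ k = 2 ∨ k = 3 ∨ k = 4 ∨ k = 5 ∨ k = 6 := by omega
      all_goals simp [b₂]
    · obtain rfl | rfl : i = 5 ∨ i = 6 := by omega
      all_goals simp [a₀]
  · rintro (h | h)
    · obtain rfl | rfl | rfl | rfl | rfl | rfl :
        i = 1 ∨ i = 2 ∨ i = 3 ∨ i = 4 ∨ i = 5 ∨ i = 6 := by omega
      all_goals simp [a₂]
    · obtain rfl | rfl : k = 5 ∨ k = 6 := by omega
      all_goals simp [b₀]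
  · rintro (h | h)
    · obtain rfl | rfl | rfl | rfl : i = 3 ∨ i = 4 ∨ i = 5 ∨ i = 6 := by omega
      all_goals simp [a₁]
    · obtain rfl | rfl | rfl | rfl : k = 3 ∨ k = 4 ∨ k = 5 ∨ k = 6 := by omega
      all_goals simp [b₁]
  · intro h
    obtain rfl | rfl | rfl | rfl | rfl : k = 2 ∨ k = 3 ∨ k = 4 ∨ k = 5 ∨ k = 6 := by omega
    all_goals simp [b₁]
  · intro h
    obtain rfl | rfl | rfl : i = 4 ∨ i = 5 ∨ i = 6 := by omega
    all_goals simp [a₀₀]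
  · intro h
    obtain rfl | rfl | rfl | rfl | rfl : i = 2 ∨ i = 3 ∨ i = 4 ∨ i = 5 ∨ i = 6 := by omega
    all_goals simp [a₁]
  · intro h
    obtain rfl | rfl | rfl : k = 4 ∨ k = 5 ∨ k = 6 := by omega
    all_goals simp [b₀₀]
  · intro h
    rw [a₀.2.2.2.2.2.2.1, (c₁ h).1, mul_zero, sub_zero]
  · intro h
    rw [a₀.2.2.2.2.2.2.2.1, (c₁ h).2, mul_zero]
  · intro h
    obtain rfl | rfl | rfl | rfl : i = 3 ∨ i = 4 ∨ i = 5 ∨ i = 6 := by omega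
    all_goals simp [a₀]
  · intro h
    obtain rfl | rfl | rfl | rfl : k = 3 ∨ k = 4 ∨ k = 5 ∨ k = 6 := by omega
    all_goals simp [b₀₀]

/-- The shape of the momentum coefficients of a polynomial which is regular at infinity. -/
lemma momentum_eq [CharZero K] {F : MvPolynomial (Fin 4) K} (hF : F.totalDegree ≤ 6)
    (hn : MomentumDegreeLE F 2) {α₂ α₅ : K} (h₂ : InfinityRegularFirst F α₂)
    (h₅ : InfinityRegularSecond F α₅) :
    momentum F 2 0 = C ((paramsOf F).a 0) + C ((paramsOf F).a 1) * X 0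
      + C ((paramsOf F).a 2) * X 0 ^ 2 + C ((paramsOf F).a 3) * X 0 ^ 3
      + C ((paramsOf F).a 4) * X 0 ^ 4 ∧
    momentum F 1 1 = (C ((paramsOf F).b 0 0) + C ((paramsOf F).b 0 1) * X 1
        + C ((paramsOf F).b 0 2) * X 1 ^ 2)
      + (C ((paramsOf F).b 1 0) + C ((paramsOf F).b 1 1) * X 1
        + C ((paramsOf F).b 1 2) * X 1 ^ 2) * X 0
      + (C ((paramsOf F).b 2 0) + C ((paramsOf F).b 2 1) * X 1
        + C ((paramsOf F).b 2 2) * X 1 ^ 2) * X 0 ^ 2 ∧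
    momentum F 0 2 = C ((paramsOf F).c 0) + C ((paramsOf F).c 1) * X 1
      + C ((paramsOf F).c 2) * X 1 ^ 2 + C ((paramsOf F).c 3) * X 1 ^ 3
      + C ((paramsOf F).c 4) * X 1 ^ 4 ∧
    momentum F 1 0 = C ((paramsOf F).f 0) + C ((paramsOf F).f 1) * X 0
      + C ((paramsOf F).f 2) * X 0 ^ 2 + C (2 * α₂ * (paramsOf F).a 4) * X 0 ^ 3
      + C α₅ * X 1 * (C ((paramsOf F).b 0 2) + C ((paramsOf F).b 1 2) * X 0
        + C ((paramsOf F).b 2 2) * X 0 ^ 2) ∧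
    momentum F 0 1 = C ((paramsOf F).g 0) + C ((paramsOf F).g 1) * X 1
      + C ((paramsOf F).g 2) * X 1 ^ 2 + C (2 * α₅ * (paramsOf F).c 4) * X 1 ^ 3
      + C α₂ * X 0 * (C ((paramsOf F).b 2 0) + C ((paramsOf F).b 2 1) * X 1
        + C ((paramsOf F).b 2 2) * X 1 ^ 2) ∧
    momentum F 0 0 = C (paramsOf F).e
      + C (α₂ * (paramsOf F).f 2 - α₂ ^ 2 * (paramsOf F).a 3) * X 0
      + C (α₂ ^ 2 * (paramsOf F).a 4) * X 0 ^ 2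
      + C (α₅ * (paramsOf F).g 2 - α₅ ^ 2 * (paramsOf F).c 3) * X 1
      + C (α₅ ^ 2 * (paramsOf F).c 4) * X 1 ^ 2
      + C (α₂ * α₅ * (paramsOf F).b 2 2) * X 0 * X 1 := by
  have r {i k : ℕ} (hi : i < 7) (hk : k < 7) := coef_relations hF hn h₂ h₅ hi hk
  clear hn h₂ h₅
  have hA {i k : ℕ} (hi : i < 7) (hk : k < 7) (h : k ≠ 0 ∨ 5 ≤ i) : coef F i 2 k 0 = 0 :=
    (r hi hk).1 h
  have hC {i k : ℕ} (hi : i < 7) (hk : k < 7) (h : i ≠ 0 ∨ 5 ≤ k) : coef F i 0 k 2 = 0 :=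
    (r hi hk).2.1 h
  have hB {i k : ℕ} (hi : i < 7) (hk : k < 7) (h : 3 ≤ i ∨ 3 ≤ k) : coef F i 1 k 1 = 0 :=
    (r hi hk).2.2.1 h
  have r₀ := r (show 0 < 7 by norm_num) (show 0 < 7 by norm_num)
  obtain ⟨-, -, -, -, -, f₃, -, -, -, g₃, -, -, -, -, -, e₁₀, e₂₀, e₀₁, e₀₂⟩ := r₀
  have hf₁ {i : ℕ} (hi : i < 7) : coef F i 1 1 0 = α₅ * coef F i 1 2 1 :=
    (r hi (show 0 < 7 by norm_num)).2.2.2.1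
  have hf₂ {i k : ℕ} (hi : i < 7) (hk : k < 7) (h : 2 ≤ k) : coef F i 1 k 0 = 0 :=
    (r hi hk).2.2.2.2.1 h
  have hf₄ {i : ℕ} (hi : i < 7) (h : 4 ≤ i) : coef F i 1 0 0 = 0 :=
    (r hi (show 0 < 7 by norm_num)).2.2.2.2.2.2.1 h
  have hg₁ {k : ℕ} (hk : k < 7) : coef F 1 0 k 1 = α₂ * coef F 2 1 k 1 :=
    (r (show 0 < 7 by norm_num) hk).2.2.2.2.2.2.2.1
  have hg₂ {i k : ℕ} (hi : i < 7) (hk : k < 7) (h : 2 ≤ i) : coef F i 0 k 1 = 0 :=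
    (r hi hk).2.2.2.2.2.2.2.2.1 h
  have hg₄ {k : ℕ} (hk : k < 7) (h : 4 ≤ k) : coef F 0 0 k 1 = 0 :=
    (r (show 0 < 7 by norm_num) hk).2.2.2.2.2.2.2.2.2.2.1 h
  have he₁ {k : ℕ} (hk : k < 7) (h : 1 ≤ k) : coef F 1 0 k 0 = α₂ * coef F 2 1 k 0 :=
    (r (show 0 < 7 by norm_num) hk).2.2.2.2.2.2.2.2.2.2.2.1 h
  have he₂ {k : ℕ} (hk : k < 7) (h : 1 ≤ k) : coef F 2 0 k 0 = 0 :=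
    (r (show 0 < 7 by norm_num) hk).2.2.2.2.2.2.2.2.2.2.2.2.1 h
  have he₃ {i k : ℕ} (hi : i < 7) (hk : k < 7) (h : 3 ≤ i) : coef F i 0 k 0 = 0 :=
    (r hi hk).2.2.2.2.2.2.2.2.2.2.2.2.2.1 h
  have he₄ {k : ℕ} (hk : k < 7) (h : 3 ≤ k) : coef F 0 0 k 0 = 0 :=
    (r (show 0 < 7 by norm_num) hk).2.2.2.2.2.2.2.2.2.2.2.2.2.2.1 h
  clear r
  refine ⟨?_, ?_, ?_, ?_, ?_, ?_⟩
  · simp [momentum, paramsOf, Finset.sum_range_succ, hA]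
  · simp [momentum, paramsOf, Finset.sum_range_succ, hB]
    ring
  · simp [momentum, paramsOf, Finset.sum_range_succ, hC]
  · simp [momentum, paramsOf, Finset.sum_range_succ, hf₁, hf₂, f₃, hf₄, hB]
    ring
  · simp [momentum, paramsOf, Finset.sum_range_succ, hg₁, hg₂, g₃, hg₄, hB]
    ring
  · simp [momentum, paramsOf, Finset.sum_range_succ, he₁, he₂, he₃, he₄, hf₁, hf₂, e₁₀, e₂₀, e₀₁,
      e₀₂]
    ring

lemma eq_quadHam [CharZero K] {F : MvPolynomial (Fin 4) K} (hF : F.totalDegree ≤ 6)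
    (hn : MomentumDegreeLE F 2) {α₂ α₅ : K} (h₂ : InfinityRegularFirst F α₂)
    (h₅ : InfinityRegularSecond F α₅) :
    F = quadHam α₂ α₅ (paramsOf F) (X 0) (X 1) (X 2) (X 3) := by
  obtain ⟨hA, hB, hC, hf, hg, he⟩ := momentum_eq hF hn h₂ h₅
  have h := aeval_eq_sum_momentum hF (X : Fin 4 → MvPolynomial (Fin 4) K)
  rw [aeval_X_left_apply] at h
  have hz {j l : ℕ} (hjl : 2 < j + l) : momentum F j l = 0 := hn j l hjl
  simp [Finset.sum_range_succ, hz] at h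
  refine h.trans ?_
  rw [hA, hB, hC, hf, hg, he]
  simp [quadHam, MvPolynomial.algebraMap_eq]
  ring

lemma pointEq_paramsOf [CharZero K] {F : MvPolynomial (Fin 4) K} (hF : F.totalDegree ≤ 6)
    (hn : MomentumDegreeLE F 2) {α₂ α₅ : K} (h₂ : InfinityRegularFirst F α₂)
    (h₅ : InfinityRegularSecond F α₅) {a b α u v : K}
    (h : BlowupRegular (F - C u * X 1 - C v * X 3) a b α) :
    PointEq α₂ α₅ (paramsOf F) a b α u v := by
  obtain ⟨hA, hB, hC, hf, hg, -⟩ := momentum_eq hF hn h₂ h₅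
  have hsub (j l : ℕ) : momentum (F - C u * X 1 - C v * X 3) j l = momentum F j l -
      (if j = 1 ∧ l = 0 then C u else 0) - (if j = 0 ∧ l = 1 then C v else 0) := by
    rw [momentum_sub, momentum_sub, momentum_C_mul_X_one, momentum_C_mul_X_three]
  have key := blowup_conditions (totalDegree_sub_le hF u v) (fun j l hjl => by
    rw [hsub, hn j l hjl, if_neg (by omega), if_neg (by omega), sub_zero, sub_zero]) h
  simp only [hsub, hA, hB, hC, hf, hg] at key
  simp [pderiv_X] at key
  obtain ⟨k₁, k₂, k₃, k₄, k₅, k₆, k₇⟩ := key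
  refine ⟨?_, ?_, ?_, ?_, ?_, ?_, ?_⟩
  · linear_combination k₁
  · linear_combination k₃
  · linear_combination k₂
  · linear_combination k₄
  · linear_combination k₅
  · linear_combination k₆
  · linear_combination k₇

end Infinity

/-! ### From the charts to regularity -/

lemma algebraMap_timeField (a : TimeField) :
    algebraMap TimeField PhaseField a = algebraMap PhaseRing PhaseField (C a) := by
  rw [IsScalarTower.algebraMap_apply TimeField PhaseRing PhaseField, MvPolynomial.algebraMap_eq]

lemma algebraMap_complex (c : ℂ) :
    algebraMap ℂ PhaseField c = algebraMap TimeField PhaseField (algebraMap ℂ TimeField c) :=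
  IsScalarTower.algebraMap_apply ℂ TimeField PhaseField c

/-- Specialization of `P` to the line in the direction of the `m`-th coordinate. -/
lemma exists_polynomial_eval (P : PhaseRing) (v : Fin 4 → TimeField) (m : Fin 4) :
    ∃ p : Polynomial TimeField, ∀ y, eval (Function.update v m y) P = p.eval y := by
  refine ⟨aeval (Function.update (fun i => Polynomial.C (v i)) m Polynomial.X) P, fun y => ?_⟩
  have h : (Polynomial.aeval y).comp
      (aeval (R := TimeField) (Function.update (fun i => Polynomial.C (v i)) m Polynomial.X)) =
      aeval (Function.update v m y) := by
    ext i
    by_cases hi : i = m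
    · subst hi
      simp
    · simp [hi]
  have h' := congrArg (fun g => g P) h
  simp only [AlgHom.comp_apply, Polynomial.coe_aeval_eq_eval, aeval_eq_eval] at h'
  exact h'.symm

/-- The chart is canonical up to the motion of its centre, so dx/dt is the y-derivative of the
corrected Hamiltonian. Of the right-hand side only polynomiality matters. -/
lemma blowupRegular_of_chart {k : Fin 2} {H : PhaseRing} {a b α u v : TimeField}
    (ha : totalDeriv k H (algebraMap TimeField PhaseField a) = algebraMap TimeField PhaseField u)
    (hb : totalDeriv k H (algebraMap TimeField PhaseField b) = algebraMap TimeField PhaseField v)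
    (hα : totalDeriv k H (algebraMap TimeField PhaseField α) = 0)
    {r : Fin 4 → PhaseField} (hr : r = blowupChart (algebraMap TimeField PhaseField a)
      (algebraMap TimeField PhaseField b) (algebraMap TimeField PhaseField α))
    {P : PhaseRing} (hP : totalDeriv k H (r 0) = aeval r P) :
    BlowupRegular (H - C u * X 1 - C v * X 3) a b α := by
  intro x z w
  obtain ⟨p, hp⟩ := exists_polynomial_eval P ![x, 0, z, w] 1
  refine ⟨p, fun y hy => ?_⟩
  set c := blowupCurve a b α x z w y with hc
  have hupd : Function.update ![x, 0, z, w] 1 y = ![x, y, z, w] := by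
    ext i
    fin_cases i <;> rfl
  rw [← hp, hupd]
  have hX (i : Fin 4) : HasValue c (coord i) (c i) := by
    have := HasValue.of_polynomial c (X i)
    rwa [eval_X] at this
  have hc₁ : c 1 = 1 / y := rfl
  have hc₁' : c 1 ≠ 0 := by
    rw [hc₁]
    exact one_div_ne_zero hy
  have hv : ∀ i, HasValue c (r i) (![x, y, z, w] i) := by
    intro i
    fin_cases i
    · have := HasValue.of_polynomial c
        (-X 1 * ((X 0 - C a) * X 1 + (X 2 - C b) * X 3 - C α))
      simp only [map_mul, map_neg, map_sub, map_add, ← algebraMap_timeField] at this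
      convert this using 1
      · rw [hr]
        rfl
      · simp [hc, blowupCurve]
        field_simp
        ring
    · have := (hX 1).one_div hc₁'
      rw [hc₁, one_div_one_div] at this
      rw [hr]
      exact this
    · have := HasValue.of_polynomial c ((X 2 - C b) * X 1)
      simp only [map_mul, map_sub, ← algebraMap_timeField] at this
      convert this using 1
      · rw [hr]
        rfl
      · simp [hc, blowupCurve]
        field_simp
    · have := (hX 3).div (hX 1) hc₁'
      convert this using 1
      · rw [hr]
        rfl
      · simp [hc, blowupCurve]
        field_simp
  set E : PhaseRing := -(hamVF H 1 * ((X 0 - C a) * X 1 + (X 2 - C b) * X 3 - C α)) -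
    X 1 * ((hamVF H 0 - C u) * X 1 + (X 0 - C a) * hamVF H 1 + (hamVF H 2 - C v) * X 3 +
      (X 2 - C b) * hamVF H 3) with hE
  have hD : totalDeriv k H (r 0) = algebraMap PhaseRing PhaseField E := by
    rw [hr]
    simp only [blowupChart, Matrix.cons_val_zero, Derivation.leibniz, map_neg, map_sub, map_add,
      totalDeriv_coord, ha, hb, hα, smul_eq_mul]
    simp only [coord, hE, map_neg, map_sub, map_add, map_mul, ← algebraMap_timeField]
    ring
  have h := (HasValue.aeval hv P).unique (hP ▸ hD ▸ HasValue.of_polynomial c E)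
  rw [h, hE]
  simp [Fin.sum_univ_four, hamVF, hc, blowupCurve, blowupVelocity, pderiv_X]
  field_simp
  ring

lemma infinityRegularFirst_of_chart {k : Fin 2} {H : PhaseRing} {α : TimeField}
    (hα : totalDeriv k H (algebraMap TimeField PhaseField α) = 0) {r : Fin 4 → PhaseField}
    (hr : r = ![1 / coord 0, -coord 0 * (coord 0 * coord 1 + algebraMap TimeField PhaseField α),
      coord 2, coord 3])
    {P : PhaseRing} (hP : totalDeriv k H (r 1) = aeval r P) : InfinityRegularFirst H α := by
  intro y z w
  obtain ⟨p, hp⟩ := exists_polynomial_eval P ![0, y, z, w] 0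
  -- The sign comes from dy/dt = -∂H/∂x.
  refine ⟨-p, fun x hx => ?_⟩
  set c : Fin 4 → TimeField := ![1 / x, -(x * (x * y + α)), z, w] with hc
  have hupd : Function.update ![0, y, z, w] 0 x = ![x, y, z, w] := by
    ext i
    fin_cases i <;> rfl
  rw [Polynomial.eval_neg, ← hp, hupd]
  have hX (i : Fin 4) : HasValue c (coord i) (c i) := by
    have := HasValue.of_polynomial c (X i)
    rwa [eval_X] at this
  have hv : ∀ i, HasValue c (r i) (![x, y, z, w] i) := by
    intro i
    fin_cases i
    · have := (hX 0).one_div (one_div_ne_zero hx)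
      rw [show c 0 = 1 / x from rfl, one_div_one_div] at this
      rw [hr]
      exact this
    · have := HasValue.of_polynomial c (-X 0 * (X 0 * X 1 + C α))
      simp only [map_mul, map_neg, map_add, ← algebraMap_timeField] at this
      convert this using 1
      · rw [hr]
        rfl
      · simp [hc]
        field_simp
        ring
    · rw [hr]
      exact hX 2
    · rw [hr]
      exact hX 3
  set E : PhaseRing := -(hamVF H 0 * (2 * X 0 * X 1 + C α)) - X 0 ^ 2 * hamVF H 1 with hE
  have hD : totalDeriv k H (r 1) = algebraMap PhaseRing PhaseField E := by
    rw [hr]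
    simp only [Matrix.cons_val_one, Matrix.cons_val_zero, Derivation.leibniz, map_neg,
      map_add, totalDeriv_coord, hα, smul_eq_mul]
    simp only [coord, hE, map_neg, map_sub, map_add, map_mul, map_pow, map_ofNat,
      ← algebraMap_timeField]
    ring
  have h := (HasValue.aeval hv P).unique (hP ▸ hD ▸ HasValue.of_polynomial c E)
  rw [h, hE]
  simp [Fin.sum_univ_four, hamVF, hc]
  field_simp
  ring

lemma infinityRegularSecond_of_chart {k : Fin 2} {H : PhaseRing} {α : TimeField}
    (hα : totalDeriv k H (algebraMap TimeField PhaseField α) = 0) {r : Fin 4 → PhaseField}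
    (hr : r = ![coord 0, coord 1, 1 / coord 2,
      -(coord 2 * coord 3 + algebraMap TimeField PhaseField α) * coord 2])
    {P : PhaseRing} (hP : totalDeriv k H (r 3) = aeval r P) : InfinityRegularSecond H α := by
  intro y z w
  obtain ⟨p, hp⟩ := exists_polynomial_eval P ![z, w, 0, y] 2
  refine ⟨-p, fun x hx => ?_⟩
  set c : Fin 4 → TimeField := ![z, w, 1 / x, -(x * (x * y + α))] with hc
  have hupd : Function.update ![z, w, 0, y] 2 x = ![z, w, x, y] := by
    ext i
    fin_cases i <;> rfl
  rw [Polynomial.eval_neg, ← hp, hupd]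
  have hX (i : Fin 4) : HasValue c (coord i) (c i) := by
    have := HasValue.of_polynomial c (X i)
    rwa [eval_X] at this
  have hv : ∀ i, HasValue c (r i) (![z, w, x, y] i) := by
    intro i
    fin_cases i
    · rw [hr]
      exact hX 0
    · rw [hr]
      exact hX 1
    · have := (hX 2).one_div (one_div_ne_zero hx)
      rw [show c 2 = 1 / x from rfl, one_div_one_div] at this
      rw [hr]
      exact this
    · have := HasValue.of_polynomial c (-(X 2 * X 3 + C α) * X 2)
      simp only [map_mul, map_neg, map_add, ← algebraMap_timeField] at this
      convert this using 1
      · rw [hr]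
        rfl
      · simp [hc]
        field_simp
        ring
  set E : PhaseRing := -(hamVF H 2 * (2 * X 2 * X 3 + C α)) - X 2 ^ 2 * hamVF H 3 with hE
  have hD : totalDeriv k H (r 3) = algebraMap PhaseRing PhaseField E := by
    rw [hr]
    simp only [Matrix.cons_val, Derivation.leibniz, map_neg,
      map_add, totalDeriv_coord, hα, smul_eq_mul]
    simp only [coord, hE, map_neg, map_sub, map_add, map_mul, map_pow, map_ofNat,
      ← algebraMap_timeField]
    ring
  have h := (HasValue.aeval hv P).unique (hP ▸ hD ▸ HasValue.of_polynomial c E)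
  rw [h, hE]
  simp [Fin.sum_univ_four, hamVF, hc]
  field_simp
  ring

/-! ### Classification of the regular Hamiltonians -/

lemma eq_combination_of_regular {K : Type*} [Field K] [CharZero K] {H : MvPolynomial (Fin 4) K}
    (hH : H.totalDegree ≤ 6) {η t s α₀ α₁ α₂ α₃ α₄ α₅ u v : K} (hη₀ : η ≠ 0) (hη₁ : η ≠ 1)
    (ht₀ : t ≠ 0) (ht₁ : t ≠ 1) (htη : t ≠ η) (hs₀ : s ≠ 0) (hs₁ : s ≠ 1) (hsη : s ≠ η)
    (hts : t ≠ s) (h₀ : BlowupRegular (H - C u * X 1 - C v * X 3) t s α₀)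
    (h₁ : BlowupRegular (H - C 0 * X 1 - C 0 * X 3) η η α₁)
    (h₂ : InfinityRegularFirst H α₂)
    (h₃ : BlowupRegular (H - C 0 * X 1 - C 0 * X 3) 1 1 α₃)
    (h₄ : BlowupRegular (H - C 0 * X 1 - C 0 * X 3) 0 0 α₄)
    (h₅ : InfinityRegularSecond H α₅) :
    ∃ κ κ' e : K, H =
        C κ * quadHam α₂ α₅ (garnierParams η t s α₁ α₂ α₃ α₄ α₅) (X 0) (X 1) (X 2) (X 3) +
        C κ' * quadHam α₂ α₅ (garnierParams η s t α₁ α₅ α₃ α₄ α₂).swap (X 0) (X 1) (X 2) (X 3) +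
        C e ∧
      u = κ * (α₀ + α₁ + 2 * α₂ + α₃ + α₄ + 2 * α₅) ∧
      v = κ' * (α₀ + α₁ + 2 * α₂ + α₃ + α₄ + 2 * α₅) := by
  have hn : MomentumDegreeLE H 2 := by
    refine momentumDegreeLE_two hH hη₀ hη₁ hts ?_
    rintro w (rfl | rfl | rfl | rfl)
    exacts [⟨α₀, u, v, h₀⟩, ⟨α₁, 0, 0, h₁⟩, ⟨α₃, 0, 0, h₃⟩, ⟨α₄, 0, 0, h₄⟩]
  have ht₁' := sub_ne_zero.mpr ht₁
  have htη' := sub_ne_zero.mpr htη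
  have hs₁' := sub_ne_zero.mpr hs₁
  have hsη' := sub_ne_zero.mpr hsη
  have hP (a b α u v : K) (h : BlowupRegular (H - C u * X 1 - C v * X 3) a b α) :=
    pointEq_paramsOf hH hn h₂ h₅ h
  obtain ⟨p₁, p₃, p₄⟩ := pointEq_garnierParams_diag ht₀ ht₁ htη hts α₁ α₂ α₃ α₄ α₅
  obtain ⟨p₁', p₃', p₄'⟩ := pointEq_garnierParams_diag hs₀ hs₁ hsη hts.symm α₁ α₅ α₃ α₄ α₂
  have p₀ := pointEq_garnierParams_moving ht₀ ht₁ htη hts α₀ α₁ α₂ α₃ α₄ α₅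
  have p₀' := pointEq_garnierParams_moving hs₀ hs₁ hsη hts.symm α₀ α₁ α₅ α₃ α₄ α₂
  -- Ĥ₁ has q₁⁴p₁² coefficient 1 / (t (t - 1) (t - η)) and no p₂² term, and Ĥ₂ is symmetric. These
  -- multiples cancel both quartic coefficients.
  set κ := (paramsOf H).a 4 * (t * (t - 1) * (t - η)) with hκ
  set κ' := (paramsOf H).c 4 * (s * (s - 1) * (s - η)) with hκ'
  have diag {x α : K} {P₁ P₂ : Params K} (h : BlowupRegular (H - C 0 * X 1 - C 0 * X 3) x x α)
      (e₁ : PointEq α₂ α₅ P₁ x x α 0 0) (e₂ : PointEq α₅ α₂ P₂ x x α 0 0) :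
      PointEq α₂ α₅ ((paramsOf H).comb P₁ P₂.swap κ κ') x x α 0 0 := by
    simpa using (hP _ _ _ _ _ h).comb e₁ e₂.swap κ κ'
  obtain ⟨hcomb, hu, hv⟩ := params_eq_zero hη₀ hη₁ ht₀ ht₁ htη hs₀ hs₁ hsη hts
    (by simp [Params.comb, Params.swap, garnierParams, hκ]; field_simp; ring)
    (by simp [Params.comb, Params.swap, garnierParams, hκ']; field_simp; ring)
    ((hP _ _ _ _ _ h₀).comb p₀ p₀'.swap κ κ') (diag h₁ p₁ p₁') (diag h₃ p₃ p₃') (diag h₄ p₄ p₄')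
  refine ⟨κ, κ', (paramsOf H).e, ?_, by linear_combination hu, by linear_combination hv⟩
  have key := quadHam_comb α₂ α₅ (paramsOf H) (garnierParams η t s α₁ α₂ α₃ α₄ α₅)
    (garnierParams η s t α₁ α₅ α₃ α₄ α₂).swap κ κ' (X 0 : MvPolynomial (Fin 4) K) (X 1) (X 2) (X 3)
  rw [hcomb, ← eq_quadHam hH hn h₂ h₅] at key
  have he : quadHam α₂ α₅ (⟨0, 0, 0, 0, 0, ((paramsOf H).comb (garnierParams η t s α₁ α₂ α₃ α₄ α₅)
      (garnierParams η s t α₁ α₅ α₃ α₄ α₂).swap κ κ').e⟩ : Params K)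
      (X 0 : MvPolynomial (Fin 4) K) (X 1) (X 2) (X 3) = C (paramsOf H).e := by
    simp [quadHam, MvPolynomial.algebraMap_eq, Params.comb, Params.swap, garnierParams]
  rw [he, MvPolynomial.algebraMap_eq] at key
  linear_combination -key

lemma eval_pderiv_pderiv_quadHam {K : Type*} [Field K] (α₂ α₅ : K) (P : Params K) (x : K) :
    eval ![x, 0, 0, 0] (pderiv 1 (pderiv 1
      (quadHam α₂ α₅ P (X 0 : MvPolynomial (Fin 4) K) (X 1) (X 2) (X 3)))) =
    2 * (P.a 0 + P.a 1 * x + P.a 2 * x ^ 2 + P.a 3 * x ^ 3 + P.a 4 * x ^ 4) := by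
  simp [quadHam, MvPolynomial.algebraMap_eq, pderiv_X]
  ring

/-! ### The times -/

lemma time_ne_algebraMap (k : Fin 2) (c : ℂ) : time k ≠ algebraMap ℂ TimeField c := by
  rw [IsScalarTower.algebraMap_apply ℂ (MvPolynomial (Fin 2) ℂ) TimeField, time,
    (IsFractionRing.injective (MvPolynomial (Fin 2) ℂ) TimeField).ne_iff,
    MvPolynomial.algebraMap_eq]
  intro h
  have h' := congrArg (eval fun _ => c + 1) h
  simp at h'

lemma time_zero_ne_time_one : time 0 ≠ time 1 := by
  rw [time, time, (IsFractionRing.injective (MvPolynomial (Fin 2) ℂ) TimeField).ne_iff,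
    (X_injective).ne_iff]
  decide

lemma totalDeriv_complex (k : Fin 2) (H : PhaseRing) (c : ℂ) :
    totalDeriv k H (algebraMap TimeField PhaseField (algebraMap ℂ TimeField c)) = 0 := by
  rw [← algebraMap_complex, Derivation.map_algebraMap]

/-! ### The main theorem -/

lemma ham₁_eq_quadHam (η : ℂ) (α : Fin 6 → ℂ) (a : Fin 6 → TimeField)
    (ha : a = fun i => algebraMap ℂ TimeField (α i)) :
    ham₁ η α = quadHam (a 2) (a 5) (garnierParams (algebraMap ℂ TimeField η) (time 0) (time 1)
      (a 1) (a 2) (a 3) (a 4) (a 5)) (X 0) (X 1) (X 2) (X 3) := by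
  have h₀ := time_ne_algebraMap 0 0
  have h₁ := time_ne_algebraMap 0 1
  rw [map_zero] at h₀
  rw [map_one] at h₁
  subst ha
  exact hamExpr_eq_quadHam h₀ h₁ (time_ne_algebraMap 0 η) time_zero_ne_time_one _ _ _ _ _ _ _ _ _

lemma ham₂_eq_quadHam (η : ℂ) (α : Fin 6 → ℂ) (a : Fin 6 → TimeField)
    (ha : a = fun i => algebraMap ℂ TimeField (α i)) :
    ham₂ η α = quadHam (a 2) (a 5) (garnierParams (algebraMap ℂ TimeField η) (time 1) (time 0)
      (a 1) (a 5) (a 3) (a 4) (a 2)).swap (X 0) (X 1) (X 2) (X 3) := by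
  have h₀ := time_ne_algebraMap 1 0
  have h₁ := time_ne_algebraMap 1 1
  rw [map_zero] at h₀
  rw [map_one] at h₁
  subst ha
  rw [quadHam_swap]
  exact hamExpr_eq_quadHam h₀ h₁ (time_ne_algebraMap 1 η) time_zero_ne_time_one.symm
    _ _ _ _ _ _ _ _ _

/-- One equation per chart suffices: that of x in the blow-ups, of y in r₂ and of w in r₅. -/
lemma eq_combination_of_charts {η : ℂ} (hη₀ : η ≠ 0) (hη₁ : η ≠ 1) (α : Fin 6 → ℂ) (k : Fin 2)
    {H : PhaseRing} (hH : H.totalDegree ≤ 6)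
    (h : ∀ j, ∃ K : PhaseRing, ∀ i, totalDeriv k H (chart η α j i) =
      aeval (chart η α j) (hamVF K i)) :
    ∃ κ κ' e : TimeField, H = C κ * ham₁ η α + C κ' * ham₂ η α + C e ∧
      (if 0 = k then 1 else 0) =
        κ * algebraMap ℂ TimeField (α 0 + α 1 + 2 * α 2 + α 3 + α 4 + 2 * α 5) ∧
      (if 1 = k then 1 else 0) =
        κ' * algebraMap ℂ TimeField (α 0 + α 1 + 2 * α 2 + α 3 + α 4 + 2 * α 5) := by
  have hne (i : Fin 2) : time i ≠ 0 ∧ time i ≠ 1 := by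
    have h₀ := time_ne_algebraMap i 0
    have h₁ := time_ne_algebraMap i 1
    rw [map_zero] at h₀
    rw [map_one] at h₁
    exact ⟨h₀, h₁⟩
  have hinj := (algebraMap ℂ TimeField).injective
  have hη₀' : algebraMap ℂ TimeField η ≠ 0 := by
    rwa [Ne, map_eq_zero_iff _ hinj]
  have hη₁' : algebraMap ℂ TimeField η ≠ 1 := by
    rwa [Ne, map_eq_one_iff _ hinj]
  have hvel (i : Fin 2) : totalDeriv k H (algebraMap TimeField PhaseField (time i)) =
      algebraMap TimeField PhaseField (if i = k then 1 else 0) := by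
    rw [totalDeriv_time, apply_ite (algebraMap TimeField PhaseField), map_one, map_zero]
  have hconst (c : ℂ) := totalDeriv_complex k H c
  have hconst' (c : ℂ) : totalDeriv k H (algebraMap TimeField PhaseField (algebraMap ℂ TimeField c)) =
      algebraMap TimeField PhaseField 0 := by rw [hconst, map_zero]
  obtain ⟨K₀, h₀⟩ := h 0
  obtain ⟨K₁, h₁⟩ := h 1
  obtain ⟨K₂, h₂⟩ := h 2
  obtain ⟨K₃, h₃⟩ := h 3
  obtain ⟨K₄, h₄⟩ := h 4
  obtain ⟨K₅, h₅⟩ := h 5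
  obtain ⟨κ, κ', e, hκ, hu, hv⟩ := eq_combination_of_regular hH hη₀' hη₁' (hne 0).1 (hne 0).2
    (time_ne_algebraMap 0 η) (hne 1).1 (hne 1).2 (time_ne_algebraMap 1 η) time_zero_ne_time_one
    (blowupRegular_of_chart (hvel 0) (hvel 1) (hconst (α 0))
      (by rw [← algebraMap_complex]; rfl) (h₀ 0))
    (blowupRegular_of_chart (hconst' η) (hconst' η) (hconst (α 1))
      (by rw [← algebraMap_complex, ← algebraMap_complex]; rfl) (h₁ 0))
    (infinityRegularFirst_of_chart (hconst (α 2)) (by rw [← algebraMap_complex]; rfl) (h₂ 1))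
    (blowupRegular_of_chart (a := 1) (b := 1) (by simp) (by simp)
      (hconst (α 3)) (by rw [← algebraMap_complex, map_one]; rfl) (h₃ 0))
    (blowupRegular_of_chart (a := 0) (b := 0) (by simp) (by simp)
      (hconst (α 4)) (by rw [← algebraMap_complex, map_zero]; rfl) (h₄ 0))
    (infinityRegularSecond_of_chart (hconst (α 5)) (by rw [← algebraMap_complex]; rfl) (h₅ 3))
  have h2 : algebraMap ℂ TimeField 2 = 2 := map_ofNat _ 2
  refine ⟨κ, κ', e, ?_, by simpa [h2] using hu, by simpa [h2] using hv⟩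
  rw [ham₁_eq_quadHam η α _ rfl, ham₂_eq_quadHam η α _ rfl]
  exact hκ

/-- Ĥ₂ has no p₁² term, so κ is determined by the coefficient of p₁². -/
lemma eq_one_of_pderiv_eq (η : ℂ) (α : Fin 6 → ℂ) {κ κ' e : TimeField}
    (h : pderiv 1 (C κ * ham₁ η α + C κ' * ham₂ η α + C e) = pderiv 1 (ham₁ η α)) : κ = 1 := by
  -- At q₁ = s the p₁² coefficient of Ĥ₁, proportional to q₁ (q₁ - 1) (q₁ - η) (q₁ - t), does not
  -- vanish.
  have h' := congrArg (fun F => eval ![time 1, 0, 0, 0] (pderiv 1 F)) h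
  simp only [map_add, pderiv_mul, pderiv_C, zero_mul, zero_add, add_zero, map_mul, eval_C] at h'
  rw [ham₁_eq_quadHam η α _ rfl, ham₂_eq_quadHam η α _ rfl, eval_pderiv_pderiv_quadHam,
    eval_pderiv_pderiv_quadHam] at h'
  have t₀ := time_ne_algebraMap 0 0
  have t₁ := time_ne_algebraMap 0 1
  have tη := sub_ne_zero.mpr (time_ne_algebraMap 0 η)
  have s₀ := time_ne_algebraMap 1 0
  have s₁ := time_ne_algebraMap 1 1
  have sη := sub_ne_zero.mpr (time_ne_algebraMap 1 η)
  have ts := sub_ne_zero.mpr time_zero_ne_time_one.symm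
  rw [map_zero] at t₀ s₀
  rw [map_one] at t₁ s₁
  replace t₁ := sub_ne_zero.mpr t₁
  replace s₁ := sub_ne_zero.mpr s₁
  simp [garnierParams, Params.swap] at h'
  generalize algebraMap ℂ TimeField η = y at *
  generalize time 0 = t at *
  generalize time 1 = s at *
  field_simp at h'
  refine sub_eq_zero.mp ((mul_eq_zero.mp (?_ : (s - 1) * (s - y) * (s - t) * _ = 0)).resolve_left ?_)
  · linear_combination h'
  · exact mul_ne_zero (mul_ne_zero s₁ sη) ts

end Garnier

end

theorem mainTheorem1 (η : ℂ) (hη₀ : η ≠ 0) (hη₁ : η ≠ 1) (α : Fin 6 → ℂ)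
    (H₁ H₂ : Garnier.PhaseRing)
    (hdeg₁ : H₁.totalDegree = 6) (hdeg₂ : H₂.totalDegree = 6)
    (hchart : ∀ j : Fin 6, Garnier.IsPolyHamIn H₁ H₂ (Garnier.chart η α j)) :
    Garnier.hamSystem H₁ H₂ = Garnier.hamSystem (Garnier.ham₁ η α) (Garnier.ham₂ η α) ↔
      α 0 + α 1 + 2 * α 2 + α 3 + α 4 + 2 * α 5 = 1 := by
  choose K₁ K₂ hK using hchart
  obtain ⟨κ, κ', e, h₁, hu₁, hv₁⟩ := Garnier.eq_combination_of_charts hη₀ hη₁ α 0 hdeg₁.le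
    fun j => ⟨K₁ j, fun i => (hK j i).1⟩
  obtain ⟨μ, μ', e', h₂, hu₂, hv₂⟩ := Garnier.eq_combination_of_charts hη₀ hη₁ α 1 hdeg₂.le
    fun j => ⟨K₂ j, fun i => (hK j i).2⟩
  constructor
  · intro h
    have h' : pderiv 1 H₁ = pderiv 1 (Garnier.ham₁ η α) :=
      congrFun (congrArg Prod.fst h) 0
    rw [h₁] at h'
    rw [Garnier.eq_one_of_pderiv_eq η α h', if_pos rfl, one_mul] at hu₁
    exact ((map_eq_one_iff _ (algebraMap ℂ Garnier.TimeField).injective).mp hu₁.symm)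
  · intro h
    -- The velocities now give κ = 1, κ' = 0 for H₁ and μ = 0, μ' = 1 for H₂. The constants e and e'
    -- do not affect the vector fields.
    simp only [h, map_one, mul_one] at hu₁ hv₁ hu₂ hv₂
    rw [← hu₁, ← hv₁] at h₁
    rw [← hu₂, ← hv₂] at h₂
    simp at h₁ h₂
    simp [Garnier.hamSystem, Garnier.hamVF, h₁, h₂]
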